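/- A frequency is a strictly increasing sequence $\lambda=(\lambda_n)_{n\ge 1}$ of non-negative real numbers with $\lambda_n\to\infty$. A Dirichlet series $\sum a_n e^{-\lambda_n s}$ with complex coefficients is a $\lambda$-Riesz germ of a function $f$ on the open right half-plane $[\mathrm{Re}>0]$ if there are $m\ge 0$ and $\sigma\in\mathbb R$ such that $$f(s)=\lim_{x\to\infty}\sum_{\lambda_n<x}a_n e^{-\lambda_n s}\Big(1-\frac{\lambda_n}{x}\Big)^m$$ for all $s$ with $\mathrm{Re}\, s>0$ and $\mathrm{Re}\, s>\sigma$. For $\ell\ge 0$ let $H_{\infty,\ell}^{\lambda}[\mathrm{Re}>0]$ be the linear space of all holomorphic functions $f\colon[\mathrm{Re}>0]\to\mathbb C$ that have a $\lambda$-Riesz germ and satisfy $$\|f\|_{\infty,\ell}=\sup_{\mathrm{Re}\, s>0}\frac{|f(s)|}{(1+|s|)^{\ell}}<\infty,$$ normed by $\|\cdot\|_{\infty,\ell}$. Theorem. Let $k>\ell\ge 0$. Then there is a function $\mu\mapsto C(k,\ell,\mu)$, $\mu \ge 0$, such that for every frequency $\lambda$ and every $N\ge 1$ the following holds. The $N$-th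 coefficient $a_N(f)$ of a $\lambda$-Riesz germ of $f\in H_{\infty,\ell}^{\lambda}[\mathrm{Re}>0]$ is uniquely determined by $f$, and the mapping $$\mathcal C_N\colon H_{\infty,\ell}^{\lambda}[\mathrm{Re}>0]\to\mathbb C,\qquad f\mapsto a_N(f),$$ is linear and bounded. More precisely, with $\lambda_0:=0$, $$\|\mathcal C_N\|\le C(k,\ell,\mu)\left(\Big(\frac{\lambda_{N+1}}{\lambda_{N+1}-\lambda_N}\Big)^k+\Big(\frac{\lambda_N}{\lambda_N-\lambda_{N-1}}\Big)^k\right),$$ where one may take $\mu=\lambda_1$ if $\lambda_1>0$ or $\ell=0$, and $\mu=\lambda_2$ if $\lambda_1=0$; if $N=1$ and $\lambda_1=0$, the second summand is read as $0$. -/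

import Mathlib

open Filter Topology

noncomputable section

/-- A frequency: a strictly increasing sequence of non-negative reals tending to `∞`.
The sequence is indexed from `0`, so that `lam n` is the term usually written `λ_{n+1}`. -/
structure Frequency where
  toFun : ℕ → ℝ
  nonneg' : ∀ n, 0 ≤ toFun n
  strictMono' : StrictMono toFun
  tendsto' : Tendsto toFun atTop atTop

instance : CoeFun Frequency (fun _ => ℕ → ℝ) := ⟨Frequency.toFun⟩

theorem Frequency.finite_lt (lam : Frequency) (x : ℝ) : {n : ℕ | lam n < x}.Finite := by
  have h := (lam.tendsto'.eventually_ge_atTop x)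
  rw [eventually_atTop] at h
  obtain ⟨N, hN⟩ := h
  refine (Set.finite_lt_nat N).subset ?_
  intro n hn
  by_contra hc
  exact absurd (hN n (not_lt.mp hc)) (not_le.mpr hn)

/-- The finite set of indices `n` with `lam n < x`. -/
def Frequency.below (lam : Frequency) (x : ℝ) : Finset ℕ := (lam.finite_lt x).toFinset

theorem Frequency.mem_below (lam : Frequency) (x : ℝ) (n : ℕ) :
    n ∈ lam.below x ↔ lam n < x := by
  simp [Frequency.below]

/-- The term preceding `lam N`, where the term preceding the first one is `0`. -/
def Frequency.prev (lam : Frequency) : ℕ → ℝ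
  | 0 => 0
  | n + 1 => lam n

/-- The open right half-plane `[Re > 0]`. -/
abbrev RHP : Type := {s : ℂ // 0 < s.re}

/-- The Riesz mean
`R_x^{λ,k}(D)(s) = ∑_{λ_n < x} a_n e^{-λ_n s} (1 - λ_n / x)^k` of the Dirichlet series
`D = ∑ a_n e^{-λ_n s}`. -/
def rieszMean (lam : Frequency) (k : ℝ) (a : ℕ → ℂ) (s : ℂ) (x : ℝ) : ℂ :=
  ∑ n ∈ lam.below x, a n * Complex.exp (-(lam n : ℂ) * s) * (((1 - lam n / x) ^ k : ℝ) : ℂ)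

/-- `f` is holomorphic on the right half-plane. -/
def IsHolo (f : RHP → ℂ) : Prop :=
  ∃ F : ℂ → ℂ, DifferentiableOn ℂ F {s : ℂ | 0 < s.re} ∧ ∀ s : RHP, F s = f s

/-- The Dirichlet series `∑ a_n e^{-λ_n s}` is a `λ`-Riesz germ of `f`: for some order `m ≥ 0`
its Riesz means of order `m` converge to `f` on some half-plane `[Re > σ]`. -/
def IsRieszGerm (lam : Frequency) (a : ℕ → ℂ) (f : RHP → ℂ) : Prop :=
  ∃ m : ℝ, 0 ≤ m ∧ ∃ σ : ℝ, ∀ s : RHP, σ < (s : ℂ).re →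
    Tendsto (fun x : ℝ => rieszMean lam m a s x) atTop (𝓝 (f s))

/-- The quotients whose supremum is `‖f‖_{∞,ℓ}`. -/
def growthQuot (l : ℝ) (f : RHP → ℂ) (s : RHP) : ℝ := ‖f s‖ / (1 + ‖(s : ℂ)‖) ^ l

/-! ### Raising the order of Riesz summability (needed for closedness under addition) -/

theorem riesz_beta {m p b x : ℝ} (hb : 0 ≤ b) (hbx : b < x) :
    ∫ u in (0 : ℝ)..1, (if b < x * u then (1 - b / (x * u)) ^ m else 0) * (u ^ m * (1 - u) ^ p)
      = (1 - b / x) ^ (m + p + 1) * ∫ v in (0 : ℝ)..1, v ^ m * (1 - v) ^ p := by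
  have hx : 0 < x := lt_of_le_of_lt hb hbx
  set c := b / x with hc
  have hc0 : 0 ≤ c := by positivity
  have hc1 : c < 1 := by rw [hc, div_lt_one hx]; exact hbx
  have key : ∀ u ∈ Set.Ioc (0 : ℝ) 1,
      (if b < x * u then (1 - b / (x * u)) ^ m else 0) * (u ^ m * (1 - u) ^ p)
        = Set.indicator (Set.Ioc c 1) (fun u => (u - c) ^ m * (1 - u) ^ p) u := by
    intro u hu
    have hu0 := hu.1
    have hiff : b < x * u ↔ c < u := by rw [hc, div_lt_iff₀ hx, mul_comm]
    by_cases h : c < u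
    · rw [if_pos (hiff.mpr h), Set.indicator_of_mem (show u ∈ Set.Ioc c 1 from ⟨h, hu.2⟩)]
      rw [← mul_assoc, ← Real.mul_rpow _ hu0.le]
      · congr 2
        rw [hc]; field_simp
      · have : 0 < x * u := by positivity
        rw [sub_nonneg, div_le_one this]
        exact (hiff.mpr h).le
    · rw [if_neg (fun h' => h (hiff.mp h')), Set.indicator_of_notMem (fun h' => h h'.1), zero_mul]
  rw [intervalIntegral.integral_of_le zero_le_one,
    MeasureTheory.setIntegral_congr_fun measurableSet_Ioc key,
    MeasureTheory.setIntegral_indicator measurableSet_Ioc,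
    Set.inter_eq_self_of_subset_right (Set.Ioc_subset_Ioc_left hc0),
    ← intervalIntegral.integral_of_le hc1.le]
  have hd : 0 < 1 - c := by linarith
  have hs := intervalIntegral.integral_comp_mul_add (a := 0) (b := 1)
    (fun u => (u - c) ^ m * (1 - u) ^ p) hd.ne' c
  simp only [mul_zero, zero_add, mul_one, sub_add_cancel, smul_eq_mul] at hs
  rw [eq_inv_mul_iff_mul_eq₀ hd.ne'] at hs
  rw [← hs, Real.rpow_add hd, Real.rpow_one, mul_comm _ (1 - c), mul_assoc]
  congr 1
  rw [← intervalIntegral.integral_const_mul]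
  refine intervalIntegral.integral_congr ?_
  intro v hv
  rw [Set.uIcc_of_le zero_le_one] at hv
  simp only
  rw [show (1 - c) * v + c - c = (1 - c) * v by ring,
    show 1 - ((1 - c) * v + c) = (1 - c) * (1 - v) by ring,
    Real.mul_rpow hd.le hv.1, Real.mul_rpow hd.le (sub_nonneg.mpr hv.2), Real.rpow_add hd]
  ring

theorem beta_pos {m p : ℝ} (hm : 0 ≤ m) (hp : 0 ≤ p) :
    0 < ∫ v in (0 : ℝ)..1, v ^ m * (1 - v) ^ p := by
  refine intervalIntegral.intervalIntegral_pos_of_pos_on ?_ ?_ zero_lt_one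
  · apply Continuous.intervalIntegrable
    exact (Real.continuous_rpow_const hm).mul
      ((Real.continuous_rpow_const hp).comp (continuous_const.sub continuous_id))
  · intro v hv
    exact mul_pos (Real.rpow_pos_of_pos hv.1 _) (Real.rpow_pos_of_pos (by linarith [hv.2]) _)

theorem riesz_kernel_integrable {m p b x : ℝ} (hm : 0 ≤ m) (hp : 0 ≤ p) (hb : 0 ≤ b)
    (hx : 0 < x) :
    IntervalIntegrable (fun u : ℝ =>
      (if b < x * u then (1 - b / (x * u)) ^ m else 0) * (u ^ m * (1 - u) ^ p))
      MeasureTheory.volume 0 1 := by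
  rw [intervalIntegrable_iff_integrableOn_Ioc_of_le zero_le_one]
  refine MeasureTheory.Measure.integrableOn_of_bounded (M := 1) (by simp) ?_ ?_
  · apply Measurable.aestronglyMeasurable
    refine Measurable.mul (Measurable.ite ?_ ?_ measurable_const) ?_
    · exact measurableSet_lt measurable_const (measurable_const.mul measurable_id)
    · fun_prop
    · fun_prop
  · refine (MeasureTheory.ae_restrict_iff' measurableSet_Ioc).mpr (Eventually.of_forall ?_)
    intro u hu
    have h1 : 0 ≤ u ^ m := Real.rpow_nonneg hu.1.le _
    have h2 : u ^ m ≤ 1 := Real.rpow_le_one hu.1.le hu.2 hm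
    have h3 : 0 ≤ (1 - u) ^ p := Real.rpow_nonneg (by linarith [hu.2]) _
    have h4 : (1 - u) ^ p ≤ 1 := Real.rpow_le_one (by linarith [hu.2]) (by linarith [hu.1]) hp
    have hw : ‖u ^ m * (1 - u) ^ p‖ ≤ 1 := by
      rw [Real.norm_of_nonneg (mul_nonneg h1 h3)]
      exact mul_le_one₀ h2 h3 h4
    have hk : ‖(if b < x * u then (1 - b / (x * u)) ^ m else 0 : ℝ)‖ ≤ 1 := by
      split_ifs with h
      · have hpos : 0 < x * u := mul_pos hx hu.1
        have h5 : 0 ≤ b / (x * u) := by positivity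
        have h6 : 0 ≤ 1 - b / (x * u) := by
          rw [sub_nonneg, div_le_one hpos]; exact h.le
        rw [Real.norm_of_nonneg (Real.rpow_nonneg h6 _)]
        exact Real.rpow_le_one h6 (by linarith) hm
      · simp
    rw [norm_mul]
    exact mul_le_one₀ hk (norm_nonneg _) hw

theorem rieszMean_bounded (lam : Frequency) {m : ℝ} (hm : 0 ≤ m) (a : ℕ → ℂ)
    (s L : ℂ) (h : Tendsto (fun x : ℝ => rieszMean lam m a s x) atTop (𝓝 L)) :
    ∃ K : ℝ, ∀ x : ℝ, ‖rieszMean lam m a s x‖ ≤ K := by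
  have h1 : ∀ᶠ x : ℝ in atTop, ‖rieszMean lam m a s x‖ < ‖L‖ + 1 :=
    h.norm.eventually_lt_const (by linarith)
  rw [eventually_atTop] at h1
  obtain ⟨Y, hY⟩ := h1
  refine ⟨max (‖L‖ + 1) (∑ n ∈ lam.below Y, ‖a n * Complex.exp (-(lam n : ℂ) * s)‖), ?_⟩
  intro x
  rcases le_total Y x with hx | hx
  · exact (hY x hx).le.trans (le_max_left _ _)
  · refine le_trans ?_ (le_max_right _ _)
    have hsub : lam.below x ⊆ lam.below Y := by
      intro n hn
      rw [Frequency.mem_below] at hn ⊢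
      exact lt_of_lt_of_le hn hx
    refine le_trans ?_ (Finset.sum_le_sum_of_subset_of_nonneg hsub
      (fun _ _ _ => norm_nonneg _))
    refine (norm_sum_le _ _).trans (Finset.sum_le_sum ?_)
    intro n hn
    rw [Frequency.mem_below] at hn
    have h0 := lam.nonneg' n
    have hx0 : 0 < x := lt_of_le_of_lt h0 hn
    have h5 : 0 ≤ lam n / x := by positivity
    have h6 : 0 ≤ 1 - lam n / x := by
      rw [sub_nonneg, div_le_one hx0]; exact hn.le
    rw [norm_mul]
    refine mul_le_of_le_one_right (norm_nonneg _) ?_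
    rw [Complex.norm_real, Real.norm_of_nonneg (Real.rpow_nonneg h6 _)]
    exact Real.rpow_le_one h6 (by linarith) hm

theorem rieszMean_scale (lam : Frequency) (m : ℝ) (a : ℕ → ℂ) (s : ℂ) {x u : ℝ} (hx : 0 < x)
    (hu : u ≤ 1) :
    rieszMean lam m a s (x * u) = ∑ n ∈ lam.below x, a n * Complex.exp (-(lam n : ℂ) * s) *
      ((if lam n < x * u then (1 - lam n / (x * u)) ^ m else 0 : ℝ) : ℂ) := by
  unfold rieszMean
  have hsub : lam.below (x * u) ⊆ lam.below x := by
    intro n hn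
    rw [Frequency.mem_below] at hn ⊢
    exact lt_of_lt_of_le hn (by nlinarith)
  rw [← Finset.sum_subset hsub]
  · refine Finset.sum_congr rfl ?_
    intro n hn
    rw [Frequency.mem_below] at hn
    rw [if_pos hn]
  · intro n _ hn
    rw [Frequency.mem_below] at hn
    rw [if_neg hn]
    simp

theorem rieszMean_raise (lam : Frequency) {m p : ℝ} (hm : 0 ≤ m) (hp : 0 ≤ p) (a : ℕ → ℂ)
    (s L : ℂ) (h : Tendsto (fun x : ℝ => rieszMean lam m a s x) atTop (𝓝 L)) :
    Tendsto (fun x : ℝ => rieszMean lam (m + p + 1) a s x) atTop (𝓝 L) := by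
  set w : ℝ → ℝ := fun u => u ^ m * (1 - u) ^ p with hw
  set B : ℝ := ∫ v in (0 : ℝ)..1, w v with hB
  have hBpos : 0 < B := beta_pos hm hp
  have hBC : (B : ℂ) ≠ 0 := by exact_mod_cast hBpos.ne'
  obtain ⟨K, hK⟩ := rieszMean_bounded lam hm a s L h
  have hint : ∀ x : ℝ, 0 < x → ∀ n, IntervalIntegrable (fun u : ℝ =>
      a n * Complex.exp (-(lam n : ℂ) * s) *
        (((if lam n < x * u then (1 - lam n / (x * u)) ^ m else 0) * w u : ℝ) : ℂ))
      MeasureTheory.volume 0 1 := by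
    intro x hx n
    apply IntervalIntegrable.const_mul
    have h0 := riesz_kernel_integrable hm hp (lam.nonneg' n) hx
    exact ⟨h0.1.ofReal, h0.2.ofReal⟩
  have hpt : ∀ x : ℝ, 0 < x → ∀ u : ℝ, u ≤ 1 → rieszMean lam m a s (x * u) * (w u : ℂ) =
      ∑ n ∈ lam.below x, a n * Complex.exp (-(lam n : ℂ) * s) *
        (((if lam n < x * u then (1 - lam n / (x * u)) ^ m else 0) * w u : ℝ) : ℂ) := by
    intro x hx u hu
    rw [rieszMean_scale lam m a s hx hu, Finset.sum_mul]
    refine Finset.sum_congr rfl ?_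
    intro n _
    push_cast
    ring
  have hformula : ∀ x : ℝ, 0 < x →
      ∫ u in (0 : ℝ)..1, rieszMean lam m a s (x * u) * (w u : ℂ)
        = rieszMean lam (m + p + 1) a s x * B := by
    intro x hx
    have : ∫ u in (0 : ℝ)..1, rieszMean lam m a s (x * u) * (w u : ℂ) =
        ∫ u in (0 : ℝ)..1, ∑ n ∈ lam.below x, a n * Complex.exp (-(lam n : ℂ) * s) *
        (((if lam n < x * u then (1 - lam n / (x * u)) ^ m else 0) * w u : ℝ) : ℂ) := by
      refine intervalIntegral.integral_congr ?_
      intro u hu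
      rw [Set.uIcc_of_le zero_le_one] at hu
      exact hpt x hx u hu.2
    rw [this, intervalIntegral.integral_finsetSum (fun n _ => hint x hx n)]
    unfold rieszMean
    rw [Finset.sum_mul]
    refine Finset.sum_congr rfl ?_
    intro n hn
    rw [Frequency.mem_below] at hn
    rw [intervalIntegral.integral_const_mul, intervalIntegral.integral_ofReal,
      riesz_beta (lam.nonneg' n) hn]
    push_cast
    ring
  have hlim : Tendsto (fun x : ℝ => ∫ u in (0 : ℝ)..1, rieszMean lam m a s (x * u) * (w u : ℂ))
      atTop (𝓝 (∫ u in (0 : ℝ)..1, L * (w u : ℂ))) := by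
    refine intervalIntegral.tendsto_integral_filter_of_dominated_convergence (fun _ => K) ?_ ?_
      intervalIntegrable_const ?_
    · filter_upwards [eventually_gt_atTop (0 : ℝ)] with x hx
      have hs : MeasureTheory.AEStronglyMeasurable (fun u : ℝ => ∑ n ∈ lam.below x,
          a n * Complex.exp (-(lam n : ℂ) * s) *
        (((if lam n < x * u then (1 - lam n / (x * u)) ^ m else 0) * w u : ℝ) : ℂ))
          (MeasureTheory.volume.restrict (Set.uIoc 0 1)) := by
        refine Finset.aestronglyMeasurable_fun_sum _ fun n _ => ?_
        rw [Set.uIoc_of_le zero_le_one]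
        exact (hint x hx n).1.aestronglyMeasurable
      refine hs.congr ?_
      refine (MeasureTheory.ae_restrict_iff' measurableSet_uIoc).mpr (Eventually.of_forall ?_)
      intro u hu
      rw [Set.uIoc_of_le zero_le_one] at hu
      exact (hpt x hx u hu.2).symm
    · refine Eventually.of_forall fun x => Eventually.of_forall fun u hu => ?_
      rw [Set.uIoc_of_le zero_le_one] at hu
      have h1 : 0 ≤ u ^ m := Real.rpow_nonneg hu.1.le _
      have h2 : u ^ m ≤ 1 := Real.rpow_le_one hu.1.le hu.2 hm
      have h3 : 0 ≤ (1 - u) ^ p := Real.rpow_nonneg (by linarith [hu.2]) _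
      have h4 : (1 - u) ^ p ≤ 1 := Real.rpow_le_one (by linarith [hu.2]) (by linarith [hu.1]) hp
      rw [norm_mul, Complex.norm_real, Real.norm_of_nonneg (mul_nonneg h1 h3)]
      exact (mul_le_of_le_one_right (norm_nonneg _) (mul_le_one₀ h2 h3 h4)).trans (hK _)
    · refine Eventually.of_forall fun u hu => ?_
      rw [Set.uIoc_of_le zero_le_one] at hu
      exact (h.comp (tendsto_id.atTop_mul_const hu.1)).mul_const _
  rw [intervalIntegral.integral_const_mul, intervalIntegral.integral_ofReal] at hlim
  have h2 := hlim.div_const (B : ℂ)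
  rw [mul_div_assoc, div_self hBC, mul_one] at h2
  refine h2.congr' ?_
  filter_upwards [eventually_gt_atTop (0 : ℝ)] with x hx
  rw [hformula x hx, mul_div_assoc, div_self hBC, mul_one]

/-! ### The spaces `H_{∞,ℓ}^λ[Re > 0]` -/

theorem IsRieszGerm.add {lam : Frequency} {a b : ℕ → ℂ} {f g : RHP → ℂ}
    (hf : IsRieszGerm lam a f) (hg : IsRieszGerm lam b g) :
    IsRieszGerm lam (a + b) (f + g) := by
  obtain ⟨m, hm, σ, h⟩ := hf
  obtain ⟨m', hm', σ', h'⟩ := hg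
  refine ⟨m + m' + 1, by positivity, max σ σ', fun s hs => ?_⟩
  have h1 := rieszMean_raise lam hm hm' a s _ (h s (lt_of_le_of_lt (le_max_left _ _) hs))
  have h2 := rieszMean_raise lam hm' hm b s _ (h' s (lt_of_le_of_lt (le_max_right _ _) hs))
  rw [add_comm m' m] at h2
  refine (h1.add h2).congr fun x => ?_
  simp only [rieszMean, Pi.add_apply, ← Finset.sum_add_distrib]
  exact Finset.sum_congr rfl fun n _ => by ring

theorem IsRieszGerm.smul {lam : Frequency} {a : ℕ → ℂ} {f : RHP → ℂ} (c : ℂ)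
    (hf : IsRieszGerm lam a f) : IsRieszGerm lam (c • a) (c • f) := by
  obtain ⟨m, hm, σ, h⟩ := hf
  refine ⟨m, hm, σ, fun s hs => ?_⟩
  refine ((h s hs).const_mul c).congr fun x => ?_
  simp only [rieszMean, Pi.smul_apply, smul_eq_mul, Finset.mul_sum]
  exact Finset.sum_congr rfl fun n _ => by ring

theorem growth_pos (l : ℝ) (s : RHP) : 0 < (1 + ‖(s : ℂ)‖) ^ l :=
  Real.rpow_pos_of_pos (by positivity) _

theorem growthQuot_nonneg (l : ℝ) (f : RHP → ℂ) (s : RHP) : 0 ≤ growthQuot l f s :=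
  div_nonneg (norm_nonneg _) (growth_pos l s).le

theorem growthQuot_add_le (l : ℝ) (f g : RHP → ℂ) (s : RHP) :
    growthQuot l (f + g) s ≤ growthQuot l f s + growthQuot l g s := by
  unfold growthQuot
  rw [← add_div]
  exact div_le_div_of_nonneg_right (norm_add_le _ _) (growth_pos l s).le

theorem growthQuot_smul (l : ℝ) (c : ℂ) (f : RHP → ℂ) (s : RHP) :
    growthQuot l (c • f) s = ‖c‖ * growthQuot l f s := by
  simp [growthQuot, mul_div_assoc]

/-- The linear space `H_{∞,ℓ}^λ[Re > 0]`: holomorphic functions on the right half-plane that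
are generated by a `λ`-Riesz germ and satisfy `sup_{Re s > 0} |f(s)| / (1 + |s|)^ℓ < ∞`. -/
def hSubmodule (lam : Frequency) (l : ℝ) : Submodule ℂ (RHP → ℂ) where
  carrier := {f | IsHolo f ∧ (∃ a : ℕ → ℂ, IsRieszGerm lam a f) ∧
    BddAbove (Set.range (growthQuot l f))}
  add_mem' := by
    rintro f g ⟨⟨F, hF, hFf⟩, ⟨a, ha⟩, ⟨A, hA⟩⟩ ⟨⟨G, hG, hGg⟩, ⟨b, hb⟩, ⟨B, hB⟩⟩
    refine ⟨⟨F + G, hF.add hG, fun s => by simp [hFf, hGg]⟩, ⟨a + b, ha.add hb⟩, A + B, ?_⟩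
    rintro _ ⟨s, rfl⟩
    exact (growthQuot_add_le l f g s).trans (add_le_add (hA ⟨s, rfl⟩) (hB ⟨s, rfl⟩))
  zero_mem' := by
    refine ⟨⟨0, differentiableOn_const 0, fun s => rfl⟩, ⟨0, 0, le_rfl, 0, fun s _ => ?_⟩, 0, ?_⟩
    · simp [rieszMean]
    · rintro _ ⟨s, rfl⟩
      simp [growthQuot]
  smul_mem' := by
    rintro c f ⟨⟨F, hF, hFf⟩, ⟨a, ha⟩, ⟨A, hA⟩⟩
    refine ⟨⟨c • F, hF.const_smul c, fun s => by simp [hFf]⟩, ⟨c • a, ha.smul c⟩, ‖c‖ * A, ?_⟩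
    rintro _ ⟨s, rfl⟩
    rw [growthQuot_smul]
    exact mul_le_mul_of_nonneg_left (hA ⟨s, rfl⟩) (norm_nonneg _)

/-- `H_{∞,ℓ}^λ[Re > 0]` as a type of its own, which carries the topology of the norm
`‖f‖_{∞,ℓ}` and not that of pointwise convergence. -/
def DirichletH (lam : Frequency) (l : ℝ) : Type := hSubmodule lam l

namespace DirichletH

variable {lam : Frequency} {l : ℝ}

instance : AddCommGroup (DirichletH lam l) := inferInstanceAs (AddCommGroup (hSubmodule lam l))

instance : Module ℂ (DirichletH lam l) := inferInstanceAs (Module ℂ (hSubmodule lam l))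

/-- The underlying function on the right half-plane. -/
def toFun (f : DirichletH lam l) : RHP → ℂ := f.1

/-- The norm `‖f‖_{∞,ℓ} = sup_{Re s > 0} |f(s)| / (1 + |s|)^ℓ`. -/
instance : Norm (DirichletH lam l) := ⟨fun f => ⨆ s : RHP, growthQuot l f.toFun s⟩

theorem norm_def (f : DirichletH lam l) : ‖f‖ = ⨆ s : RHP, growthQuot l f.toFun s := rfl

theorem bdd (f : DirichletH lam l) : BddAbove (Set.range (growthQuot l f.toFun)) := f.2.2.2

theorem core : NormedSpace.Core ℂ (DirichletH lam l) where
  norm_nonneg f := Real.iSup_nonneg fun s => growthQuot_nonneg l _ s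
  norm_smul c f := by
    rw [norm_def, norm_def, Real.mul_iSup_of_nonneg (norm_nonneg c)]
    exact iSup_congr fun s => growthQuot_smul l c f.toFun s
  norm_triangle f g := by
    refine Real.iSup_le (fun s => ?_) (add_nonneg
      (Real.iSup_nonneg fun s => growthQuot_nonneg l _ s)
      (Real.iSup_nonneg fun s => growthQuot_nonneg l _ s))
    exact (growthQuot_add_le l f.toFun g.toFun s).trans
      (add_le_add (le_ciSup f.bdd s) (le_ciSup g.bdd s))
  norm_eq_zero_iff f := by
    constructor
    · intro h
      refine Subtype.ext (funext fun s => ?_)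
      have h1 : growthQuot l f.toFun s ≤ 0 := h ▸ le_ciSup f.bdd s
      have h2 := le_antisymm h1 (growthQuot_nonneg l _ s)
      rw [growthQuot, div_eq_zero_iff] at h2
      exact norm_eq_zero.mp (h2.resolve_right (growth_pos l s).ne')
    · rintro rfl
      have : ∀ s : RHP, growthQuot l (toFun (0 : DirichletH lam l)) s = 0 := by
        intro s
        have : toFun (0 : DirichletH lam l) s = 0 := rfl
        simp [growthQuot, this]
      simp [norm_def, this]

instance : NormedAddCommGroup (DirichletH lam l) := NormedAddCommGroup.ofCore core

instance : NormedSpace ℂ (DirichletH lam l) := NormedSpace.ofCore core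

end DirichletH

end

/-! A coefficient is a difference of two consecutive partial sums, so it suffices to recover `S_N =
∑_{n ≤ N} a_n` from `f` and to estimate it. Sharp cut-off Perron integrals converge too badly for
this. Since no frequency lies strictly between `λ_N` and `λ_{N+1}`, the cut-off may instead be any
smooth step falling from `1` to `0` on that gap. Its two-sided Laplace transform `κ` (`stepKernel`)
decays faster than every power on vertical lines, and `2π S_N = ∫ f(c + iy) κ(c + iy) dy` for every
`c > 0` (`integral_germ_stepKernel`).

For Riesz means, which are finite sums, the formula is Fourier inversion applied term by term, up to
weights `(1 - λ_n/x)^m` that tend to `1`. To let `x → ∞` under the integral on a line far to the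
right, a majorant uniform in `x` is needed: `rieszMean_vertical_bound` gives polynomial growth in
`|Im s|`, which the decay of `κ` absorbs. Cauchy's theorem (`integral_vertical_eq`) then moves the
line to any `c > 0`, because `f` has polynomial growth on the whole half-plane.

The choice `c = 1/λ_{N+1}` keeps the exponential factors of `κ` bounded. With `h = λ_{N+1} - λ_N`,
the bound `|κ(s)| ≲ |hs|^{-k} / |s|` against `(1 + |s|)^ℓ` leaves an integral that converges exactly
because `k > ℓ`, and scaling produces `(λ_{N+1}/h)^k` (`exists_partialSum_bound`). Uniqueness and
linearity follow by applying the bound to germs of `0`. -/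

/-! ### Growth of Riesz means on vertical lines -/

/-- The locally integrable functions on the real line. -/
def locIntegrable : Submodule ℂ (ℝ → ℂ) where
  carrier := {u | ∀ a b, IntervalIntegrable u MeasureTheory.volume a b}
  add_mem' hu hv a b := (hu a b).add (hv a b)
  zero_mem' _ _ := intervalIntegrable_const
  smul_mem' c _ hu a b := (hu a b).smul c

/-- The primitive vanishing at `0`, as an operator on locally integrable functions. -/
noncomputable def primitiveEnd : Module.End ℂ locIntegrable where
  toFun u := ⟨fun y => ∫ t in (0 : ℝ)..y, u.1 t, fun _ _ =>
    (intervalIntegral.continuous_primitive u.2 0).intervalIntegrable _ _⟩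
  map_add' u v := Subtype.ext <| funext fun y => by
    exact intervalIntegral.integral_add (u.2 0 y) (v.2 0 y)
  map_smul' c u := Subtype.ext <| funext fun y => by
    exact intervalIntegral.integral_smul c u.1

theorem primitiveEnd_apply (u : locIntegrable) (y : ℝ) :
    (primitiveEnd u).1 y = ∫ t in (0 : ℝ)..y, u.1 t := rfl

/-- The function `y ↦ e^{-wy} (y - b)^j`, cut off to `y > b`. -/
noncomputable def expPow (w : ℂ) (b : ℝ) (j : ℕ) : locIntegrable :=
  ⟨Set.indicator (Set.Ioi b) fun y => Complex.exp (-w * y) * ((y : ℂ) - b) ^ j, fun c d => by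
    have h : Continuous fun y : ℝ => Complex.exp (-w * y) * ((y : ℂ) - b) ^ j := by fun_prop
    exact ⟨(h.intervalIntegrable c d).1.indicator measurableSet_Ioi,
      (h.intervalIntegrable c d).2.indicator measurableSet_Ioi⟩⟩

theorem expPow_apply_of_lt (w : ℂ) {b y : ℝ} (j : ℕ) (h : b < y) :
    (expPow w b j).1 y = Complex.exp (-w * y) * ((y : ℂ) - b) ^ j :=
  Set.indicator_of_mem (s := Set.Ioi b) h fun y : ℝ => Complex.exp (-w * y) * ((y : ℂ) - b) ^ j

theorem expPow_apply_of_le (w : ℂ) {b y : ℝ} (j : ℕ) (h : y ≤ b) : (expPow w b j).1 y = 0 :=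
  Set.indicator_of_notMem (s := Set.Ioi b) (fun h' => absurd h (not_le.mpr h'))
    fun y : ℝ => Complex.exp (-w * y) * ((y : ℂ) - b) ^ j

theorem primitiveEnd_expPow_of_le (w : ℂ) {b y : ℝ} (hb : 0 ≤ b) (j : ℕ) (h : y ≤ b) :
    (primitiveEnd (expPow w b j)).1 y = 0 := by
  rw [primitiveEnd_apply]
  refine (intervalIntegral.integral_congr fun t ht => ?_).trans intervalIntegral.integral_zero
  exact expPow_apply_of_le w j (ht.2.trans (max_le hb h))

theorem primitiveEnd_expPow_of_lt (w : ℂ) {b y : ℝ} (hb : 0 ≤ b) (j : ℕ) (h : b < y) :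
    (primitiveEnd (expPow w b j)).1 y
      = ∫ t in b..y, Complex.exp (-w * t) * ((t : ℂ) - b) ^ j := by
  have h0 := primitiveEnd_expPow_of_le w hb j (le_refl b)
  rw [primitiveEnd_apply] at h0 ⊢
  rw [← intervalIntegral.integral_add_adjacent_intervals ((expPow w b j).2 0 b)
    ((expPow w b j).2 b y), h0, zero_add]
  refine intervalIntegral.integral_congr_ae (Eventually.of_forall fun t ht => ?_)
  rw [Set.uIoc_of_le h.le] at ht
  exact expPow_apply_of_lt w j ht.1

/-- Integrate the product rule for `e^{-wt} (t - b)^{j+1}` from `b` to `y`; the boundary term at `b`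
vanishes because the exponent is positive. -/
theorem one_add_primitiveEnd_expPow_succ (w : ℂ) {b : ℝ} (hb : 0 ≤ b) (j : ℕ) :
    (1 + w • primitiveEnd) (expPow w b (j + 1))
      = ((j : ℂ) + 1) • primitiveEnd (expPow w b j) := by
  refine Subtype.ext (funext fun y => ?_)
  change (expPow w b (j + 1)).1 y + w * (primitiveEnd (expPow w b (j + 1))).1 y
    = ((j : ℂ) + 1) * (primitiveEnd (expPow w b j)).1 y
  rcases le_or_gt y b with h | h
  · rw [primitiveEnd_expPow_of_le w hb _ h, primitiveEnd_expPow_of_le w hb _ h,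
      expPow_apply_of_le w _ h]
    simp
  · rw [primitiveEnd_expPow_of_lt w hb _ h, primitiveEnd_expPow_of_lt w hb _ h,
      expPow_apply_of_lt w _ h]
    have hd : ∀ t : ℝ, HasDerivAt
        (fun t : ℝ => Complex.exp (-w * t) * ((t : ℂ) - b) ^ (j + 1))
        (-w * (Complex.exp (-w * t) * ((t : ℂ) - b) ^ (j + 1))
          + (j + 1) * (Complex.exp (-w * t) * ((t : ℂ) - b) ^ j)) t := by
      intro t
      have h1 : HasDerivAt (fun z : ℂ => Complex.exp (-w * z) * (z - b) ^ (j + 1))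
          (-w * (Complex.exp (-w * t) * ((t : ℂ) - b) ^ (j + 1))
          + (j + 1) * (Complex.exp (-w * t) * ((t : ℂ) - b) ^ j)) (t : ℂ) := by
        have h2 := (((hasDerivAt_id (t : ℂ)).const_mul (-w)).cexp).mul
          (((hasDerivAt_id (t : ℂ)).sub_const (b : ℂ)).pow (j + 1))
        refine h2.congr_deriv ?_
        simp only [id, Pi.pow_apply, Nat.add_sub_cancel]
        push_cast
        ring
      exact h1.comp_ofReal
    have hc : ∀ i : ℕ, Continuous fun t : ℝ => Complex.exp (-w * t) * ((t : ℂ) - b) ^ i :=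
      fun i => by fun_prop
    have hi := intervalIntegral.integral_eq_sub_of_hasDerivAt (a := b) (b := y)
      (fun t _ => hd t)
      ((((hc (j + 1)).const_mul (-w)).add ((hc j).const_mul ((j : ℂ) + 1))).intervalIntegrable _ _)
    rw [intervalIntegral.integral_add (((hc (j + 1)).const_mul (-w)).intervalIntegrable _ _)
      (((hc j).const_mul ((j : ℂ) + 1)).intervalIntegrable _ _),
      intervalIntegral.integral_const_mul, intervalIntegral.integral_const_mul, sub_self,
      zero_pow (Nat.succ_ne_zero j), mul_zero, sub_zero] at hi
    rw [← hi]
    ring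

/-- With exponent `0` the boundary term at `b` survives, and it is the factor `e^{-wb}`. -/
theorem one_add_primitiveEnd_expPow_zero (w : ℂ) {b : ℝ} (hb : 0 ≤ b) :
    (1 + w • primitiveEnd) (expPow w b 0) = Complex.exp (-w * b) • expPow 0 b 0 := by
  refine Subtype.ext (funext fun y => ?_)
  change (expPow w b 0).1 y + w * (primitiveEnd (expPow w b 0)).1 y
    = Complex.exp (-w * b) * (expPow 0 b 0).1 y
  rcases le_or_gt y b with h | h
  · rw [primitiveEnd_expPow_of_le w hb _ h, expPow_apply_of_le w _ h, expPow_apply_of_le 0 _ h]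
    simp
  · rw [primitiveEnd_expPow_of_lt w hb _ h, expPow_apply_of_lt w _ h, expPow_apply_of_lt 0 _ h]
    have hd : ∀ t : ℝ, HasDerivAt (fun t : ℝ => Complex.exp (-w * t))
        (-w * (Complex.exp (-w * t) * ((t : ℂ) - b) ^ 0)) t := by
      intro t
      have h2 := (((hasDerivAt_id (t : ℂ)).const_mul (-w)).cexp).comp_ofReal
      refine h2.congr_deriv ?_
      simp only [id, pow_zero]
      ring
    have hi := intervalIntegral.integral_eq_sub_of_hasDerivAt (a := b) (b := y)
      (fun t _ => hd t) (Continuous.intervalIntegrable (by fun_prop) _ _)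
    rw [intervalIntegral.integral_const_mul] at hi
    simp only [neg_mul, neg_zero, zero_mul, Complex.exp_zero, pow_zero, mul_one] at hi ⊢
    linear_combination -hi

theorem primitiveEnd_expPow_zero (b : ℝ) (hb : 0 ≤ b) (j : ℕ) :
    ((j : ℂ) + 1) • primitiveEnd (expPow 0 b j) = expPow 0 b (j + 1) := by
  rw [← one_add_primitiveEnd_expPow_succ 0 hb j]
  simp

/-- The operator `(1 + w I)^{j+1}`, `I` the primitive, maps `e^{-wy} (y-b)_+^j` to
`e^{-wb} (y-b)_+^j`. -/
theorem one_add_primitiveEnd_pow_expPow (w : ℂ) {b : ℝ} (hb : 0 ≤ b) (j : ℕ) :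
    ((1 + w • primitiveEnd) ^ (j + 1)) (expPow w b j)
      = Complex.exp (-w * b) • expPow 0 b j := by
  induction j with
  | zero => rw [zero_add, pow_one, one_add_primitiveEnd_expPow_zero w hb]
  | succ j ih =>
    -- One factor `1 + wI` lowers `j + 1` to `j` at the price of an `I`. Moving this `I` past the
    -- remaining factors lets the induction hypothesis apply, and `I` then restores the exponent.
    have hcomm : ((1 + w • primitiveEnd) ^ (j + 1)) * primitiveEnd
        = primitiveEnd * ((1 + w • primitiveEnd) ^ (j + 1)) := by
      have h1 : Commute (1 + w • primitiveEnd) primitiveEnd :=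
        (Commute.one_left _).add_left ((Commute.refl _).smul_left w)
      exact (h1.pow_left (j + 1)).eq
    rw [pow_succ, Module.End.mul_apply, one_add_primitiveEnd_expPow_succ w hb, map_smul,
      ← Module.End.mul_apply, hcomm, Module.End.mul_apply, ih, map_smul, smul_comm,
      primitiveEnd_expPow_zero b hb]

/-- The first application integrates the exponential decay and costs only `1 + 1/r`, with no power
of `y`; each later one costs `(1 + ‖w‖)(1 + y)`. So `m + 1` applications give just `(1 + y)^m`,
which division by `x^m` can compensate. -/
theorem norm_one_add_primitiveEnd_pow_le (w : ℂ) (u : locIntegrable) {x K r : ℝ} (hK : 0 ≤ K)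
    (hr : 0 < r) (hu : ∀ y ∈ Set.Icc 0 x, ‖u.1 y‖ ≤ K * Real.exp (-r * y)) (i : ℕ) :
    ∀ y ∈ Set.Icc 0 x, ‖(((1 + w • primitiveEnd) ^ (i + 1)) u).1 y‖
      ≤ K * (1 + 1 / r) * (1 + ‖w‖) ^ (i + 1) * (1 + y) ^ i := by
  have hw := norm_nonneg w
  have key : ∀ (v : locIntegrable) (y : ℝ), ‖((1 + w • primitiveEnd) v).1 y‖
      ≤ ‖v.1 y‖ + ‖w‖ * ‖∫ t in (0 : ℝ)..y, v.1 t‖ := by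
    intro v y
    change ‖v.1 y + w * ∫ t in (0 : ℝ)..y, v.1 t‖ ≤ _
    exact (norm_add_le _ _).trans (by rw [norm_mul])
  induction i with
  | zero =>
    intro y hy
    rw [zero_add, pow_one]
    refine (key u y).trans ?_
    have h1 : ‖∫ t in (0 : ℝ)..y, u.1 t‖ ≤ ∫ t in (0 : ℝ)..y, K * Real.exp (-r * t) := by
      refine intervalIntegral.norm_integral_le_of_norm_le hy.1 ?_
        (Continuous.intervalIntegrable (by fun_prop) _ _)
      exact Eventually.of_forall fun t ht => hu t ⟨ht.1.le, ht.2.trans hy.2⟩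
    have h2 : ∫ t in (0 : ℝ)..y, K * Real.exp (-r * t) = K * ((1 - Real.exp (-r * y)) / r) := by
      rw [intervalIntegral.integral_const_mul, intervalIntegral.integral_comp_mul_left
        (fun t => Real.exp t) (by linarith : -r ≠ 0), integral_exp, smul_eq_mul, mul_zero,
        Real.exp_zero]
      field_simp
      ring
    have h3 : K * ((1 - Real.exp (-r * y)) / r) ≤ K * (1 / r) := by
      gcongr
      linarith [Real.exp_pos (-r * y)]
    have h4 : ‖u.1 y‖ ≤ K := by
      refine (hu y hy).trans (mul_le_of_le_one_right hK ?_)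
      rw [Real.exp_le_one_iff]
      nlinarith [hy.1]
    have h5 : 0 < 1 / r := by positivity
    rw [h2] at h1
    have h6 := mul_le_mul_of_nonneg_left (h1.trans h3) hw
    rw [pow_one, pow_zero, mul_one]
    nlinarith [mul_nonneg hK hw, mul_nonneg hK h5.le]
  | succ i ih =>
    intro y hy
    rw [pow_succ', Module.End.mul_apply]
    set v := ((1 + w • primitiveEnd) ^ (i + 1)) u with hv
    set M := K * (1 + 1 / r) * (1 + ‖w‖) ^ (i + 1) with hM
    have hM0 : 0 ≤ M := by positivity
    refine (key v y).trans ?_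
    have hy0 := hy.1
    have h1 : ‖∫ t in (0 : ℝ)..y, v.1 t‖ ≤ M * (1 + y) ^ i * |y - 0| := by
      refine intervalIntegral.norm_integral_le_of_norm_le_const fun t ht => ?_
      rw [Set.uIoc_of_le hy.1] at ht
      refine (ih t ⟨ht.1.le, ht.2.trans hy.2⟩).trans ?_
      have := ht.1.le
      have := ht.2
      gcongr
    rw [sub_zero, abs_of_nonneg hy.1] at h1
    have h2 := ih y hy
    have h3 := mul_le_mul_of_nonneg_left h1 hw
    have h4 : K * (1 + 1 / r) * (1 + ‖w‖) ^ (i + 1 + 1) * (1 + y) ^ (i + 1)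
        = M * (1 + y) ^ i * ((1 + ‖w‖) * (1 + y)) := by rw [hM]; ring
    rw [h4]
    have h5 : 0 ≤ M * (1 + y) ^ i := by positivity
    nlinarith [mul_nonneg h5 hw, mul_nonneg h5 hy0]

/-- Bounded Riesz means at `s₀` grow at most polynomially on each vertical line to the right. -/
theorem rieszMean_vertical_bound (lam : Frequency) (m : ℕ) (a : ℕ → ℂ) (s₀ : ℂ) {K r : ℝ}
    (hK : ∀ x, ‖rieszMean lam m a s₀ x‖ ≤ K) (hr : 0 < r) :
    ∃ K' : ℝ, ∀ w : ℂ, w.re = r → ∀ x : ℝ, 1 ≤ x →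
      ‖rieszMean lam m a (s₀ + w) x‖ ≤ K' * (1 + ‖w‖) ^ (m + 1) := by
  have hK0 : 0 ≤ K := (norm_nonneg _).trans (hK 0)
  -- Half of the decay `e^{-ry}` is spent on absorbing `y^m ≤ m! (2/r)^m e^{ry/2}`; the rate `r/2`
  -- remains.
  set L : ℝ := K * (m.factorial * (2 / r) ^ m) with hL
  have hL0 : 0 ≤ L := by positivity
  refine ⟨L * (1 + 1 / (r / 2)) * 2 ^ m, fun w hw x hx => ?_⟩
  have hx0 : 0 < x := by linarith
  -- For `0 ≤ y ≤ x` this is `e^{-wy} y^m` times the Riesz mean at `s₀` with parameter `y`. Applying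
  -- `(1 + wI)^{m+1}` and evaluating at `x` gives `x^m` times the Riesz mean at `s₀ + w`.
  set u : locIntegrable :=
    ∑ n ∈ lam.below x, (a n * Complex.exp (-(lam n : ℂ) * s₀)) • expPow w (lam n) m with hu
  have happ : ∀ (F : Finset ℕ) (c : ℕ → ℂ) (e : ℕ → locIntegrable) (y : ℝ),
      (∑ n ∈ F, c n • e n).1 y = ∑ n ∈ F, c n * (e n).1 y := by
    intro F c e y
    simp [Finset.sum_apply]
  have hbd : ∀ y ∈ Set.Icc 0 x, ‖u.1 y‖ ≤ L * Real.exp (-(r / 2) * y) := by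
    intro y hy
    have h1 : u.1 y = Complex.exp (-w * y) * ((y : ℂ) ^ m * rieszMean lam m a s₀ y) := by
      rw [hu, happ, rieszMean, Finset.mul_sum, Finset.mul_sum]
      have hsub : lam.below y ⊆ lam.below x := by
        intro n hn
        rw [Frequency.mem_below] at hn ⊢
        exact hn.trans_le hy.2
      rw [← Finset.sum_subset hsub]
      · refine Finset.sum_congr rfl fun n hn => ?_
        rw [Frequency.mem_below] at hn
        have hy0 : (y : ℂ) ≠ 0 := by
          exact_mod_cast (lt_of_le_of_lt (lam.nonneg' n) hn).ne'
        rw [expPow_apply_of_lt w m hn, Real.rpow_natCast]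
        have : ((y : ℂ) - lam n) ^ m = (y : ℂ) ^ m * (1 - lam n / y) ^ m := by
          rw [← mul_pow, mul_sub, mul_one, mul_div_cancel₀ _ hy0]
        rw [this]
        push_cast
        ring
      · intro n _ hn
        rw [Frequency.mem_below, not_lt] at hn
        rw [expPow_apply_of_le w m hn, mul_zero]
    have h2 : y ^ m ≤ (m.factorial * (2 / r) ^ m) * Real.exp (r / 2 * y) := by
      have hy0 := hy.1
      have h3 := Real.pow_div_factorial_le_exp (r / 2 * y) (by positivity) m
      rw [div_le_iff₀ (by positivity)] at h3
      calc y ^ m = (2 / r) ^ m * (r / 2 * y) ^ m := by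
            rw [← mul_pow]; congr 1; field_simp
        _ ≤ (2 / r) ^ m * (Real.exp (r / 2 * y) * m.factorial) := by gcongr
        _ = _ := by ring
    rw [h1, norm_mul, norm_mul, norm_pow, Complex.norm_exp, Complex.norm_real,
      Real.norm_of_nonneg hy.1]
    have h4 : (-w * y).re = -r * y := by simp [hw]
    rw [h4]
    calc Real.exp (-r * y) * (y ^ m * ‖rieszMean lam m a s₀ y‖)
        ≤ Real.exp (-r * y) * (((m.factorial * (2 / r) ^ m) * Real.exp (r / 2 * y)) * K) := by
          gcongr
          exact hK y
      _ = L * (Real.exp (-r * y) * Real.exp (r / 2 * y)) := by rw [hL]; ring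
      _ = L * Real.exp (-(r / 2) * y) := by rw [← Real.exp_add]; ring_nf
  have hfin := norm_one_add_primitiveEnd_pow_le w u hL0 (half_pos hr) hbd m x ⟨hx0.le, le_rfl⟩
  have heq : (((1 + w • primitiveEnd) ^ (m + 1)) u).1 x
      = (x : ℂ) ^ m * rieszMean lam m a (s₀ + w) x := by
    rw [hu, map_sum]
    simp only [map_smul, one_add_primitiveEnd_pow_expPow w (lam.nonneg' _) m]
    rw [happ, rieszMean, Finset.mul_sum]
    refine Finset.sum_congr rfl fun n hn => ?_
    rw [Frequency.mem_below] at hn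
    have hxc : (x : ℂ) ≠ 0 := by exact_mod_cast hx0.ne'
    change _ * (Complex.exp (-w * lam n) * (expPow 0 (lam n) m).1 x) = _
    rw [expPow_apply_of_lt 0 m hn, Real.rpow_natCast]
    have : ((x : ℂ) - lam n) ^ m = (x : ℂ) ^ m * (1 - lam n / x) ^ m := by
      rw [← mul_pow, mul_sub, mul_one, mul_div_cancel₀ _ hxc]
    rw [this, mul_add, Complex.exp_add, neg_zero, zero_mul, Complex.exp_zero,
      show -w * (lam n : ℂ) = -(lam n : ℂ) * w by ring]
    push_cast
    ring
  rw [heq, norm_mul, norm_pow, Complex.norm_real, Real.norm_of_nonneg hx0.le] at hfin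
  have hxm : 0 < x ^ m := by positivity
  refine le_of_mul_le_mul_left (hfin.trans ?_) hxm
  calc L * (1 + 1 / (r / 2)) * (1 + ‖w‖) ^ (m + 1) * (1 + x) ^ m
      ≤ L * (1 + 1 / (r / 2)) * (1 + ‖w‖) ^ (m + 1) * (2 * x) ^ m := by gcongr; linarith
    _ = _ := by rw [mul_pow]; ring

/-! ### A smooth cut-off and its Laplace transform -/

/-- Smooth functions on the line whose support is a compact part of `(0, 1)`. -/
structure IsUnitBump (g : ℝ → ℂ) : Prop where
  smooth : ContDiff ℝ (⊤ : ℕ∞) g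
  support : tsupport g ⊆ Set.Ioo 0 1

namespace IsUnitBump

theorem deriv {g : ℝ → ℂ} (hg : IsUnitBump g) : IsUnitBump (deriv g) where
  smooth := by simpa using hg.smooth.iterate_deriv 1
  support := tsupport_deriv_subset.trans hg.support

theorem eq_zero {g : ℝ → ℂ} (hg : IsUnitBump g) {x : ℝ} (hx : x ∉ Set.Ioo (0 : ℝ) 1) :
    g x = 0 :=
  image_eq_zero_of_notMem_tsupport fun h => hx (hg.support h)

theorem hasDerivAt {g : ℝ → ℂ} (hg : IsUnitBump g) (x : ℝ) :
    HasDerivAt g (_root_.deriv g x) x :=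
  (hg.smooth.differentiable (by simp) x).hasDerivAt

end IsUnitBump

theorem exists_isUnitBump : ∃ g : ℝ → ℂ, IsUnitBump g ∧ ∫ x in (0 : ℝ)..1, g x = 1 := by
  let φ : ContDiffBump (1 / 2 : ℝ) := ⟨1 / 8, 1 / 4, by norm_num, by norm_num⟩
  let g : ℝ → ℝ := φ.normed MeasureTheory.volume
  have hts : tsupport g ⊆ Set.Ioo 0 1 := by
    have h : tsupport g = Metric.closedBall (1 / 2 : ℝ) (1 / 4) :=
      φ.tsupport_normed_eq (μ := MeasureTheory.volume)
    rw [h, Real.closedBall_eq_Icc]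
    exact Set.Icc_subset_Ioo (by norm_num) (by norm_num)
  have hsupp : Function.support g ⊆ Set.Ioc 0 1 :=
    (subset_tsupport g).trans (hts.trans Set.Ioo_subset_Ioc_self)
  refine ⟨fun x => (g x : ℂ), ⟨Complex.ofRealCLM.contDiff.comp φ.contDiff_normed, ?_⟩, ?_⟩
  · have h : tsupport (fun x => (g x : ℂ)) ⊆ tsupport g :=
      tsupport_comp_subset (g := fun r : ℝ => (r : ℂ)) Complex.ofReal_zero g
    exact h.trans hts
  · rw [intervalIntegral.integral_ofReal, intervalIntegral.integral_eq_integral_of_support_subset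
      hsupp, φ.integral_normed, Complex.ofReal_one]

/-- The Laplace transform `∫₀¹ g(x) e^{zx} dx`. -/
noncomputable def unitLaplace (g : ℝ → ℂ) (z : ℂ) : ℂ :=
  ∫ x in (0 : ℝ)..1, g x * Complex.exp (z * x)

theorem differentiable_unitLaplace {g : ℝ → ℂ} (hg : Continuous g) :
    Differentiable ℂ (unitLaplace g) := by
  intro z
  have h := intervalIntegral.hasDerivAt_integral_of_dominated_loc_of_deriv_le (𝕜 := ℂ)
    (μ := MeasureTheory.volume) (a := 0) (b := 1)
    (F := fun z x => g x * Complex.exp (z * x)) (F' := fun z x => g x * (Complex.exp (z * x) * x))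
    (x₀ := z) (s := Metric.ball z 1) (bound := fun x => ‖g x‖ * Real.exp (‖z‖ + 1))
    (Metric.ball_mem_nhds z one_pos)
    (Eventually.of_forall fun w => Continuous.aestronglyMeasurable (by fun_prop))
    (Continuous.intervalIntegrable (by fun_prop) _ _)
    (Continuous.aestronglyMeasurable (by fun_prop)) ?_
    (Continuous.intervalIntegrable (by fun_prop) _ _) ?_
  · exact h.2.differentiableAt
  · refine Eventually.of_forall fun x hx w hw => ?_
    rw [Set.uIoc_of_le zero_le_one] at hx
    rw [norm_mul, norm_mul, Complex.norm_exp, Complex.norm_real, Real.norm_of_nonneg hx.1.le]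
    have h1 : (w * x).re ≤ ‖z‖ + 1 := by
      have h2 : ‖w‖ ≤ ‖z‖ + 1 := by
        have := norm_le_norm_add_norm_sub' w z
        rw [mem_ball_iff_norm] at hw
        linarith
      calc (w * x).re ≤ ‖w * x‖ := Complex.re_le_norm _
        _ = ‖w‖ * x := by rw [norm_mul, Complex.norm_real, Real.norm_of_nonneg hx.1.le]
        _ ≤ ‖w‖ := mul_le_of_le_one_right (norm_nonneg _) hx.2
        _ ≤ _ := h2
    have h3 := Real.exp_le_exp.mpr h1
    refine mul_le_mul_of_nonneg_left ?_ (norm_nonneg _)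
    exact (mul_le_of_le_one_right (Real.exp_pos _).le hx.2).trans h3
  · refine Eventually.of_forall fun x _ w _ => ?_
    have h1 := (((hasDerivAt_id w).mul_const (x : ℂ)).cexp).const_mul (g x)
    simpa using h1

theorem unitLaplace_deriv {g : ℝ → ℂ} (hg : IsUnitBump g) (z : ℂ) :
    unitLaplace (deriv g) z = -(z * unitLaplace g z) := by
  have hE : ∀ x : ℝ, HasDerivAt (fun x : ℝ => Complex.exp (z * x)) (z * Complex.exp (z * x)) x := by
    intro x
    have h := (((hasDerivAt_id (x : ℂ)).const_mul z).cexp).comp_ofReal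
    refine h.congr_deriv ?_
    simp only [id]
    ring
  have hc := hg.smooth.continuous
  have hc' := hg.deriv.smooth.continuous
  have h := intervalIntegral.integral_eq_sub_of_hasDerivAt (a := 0) (b := 1)
    (fun x _ => (hg.hasDerivAt x).mul (hE x)) (Continuous.intervalIntegrable (by fun_prop) _ _)
  rw [intervalIntegral.integral_add (Continuous.intervalIntegrable (by fun_prop) _ _)
    (Continuous.intervalIntegrable (by fun_prop) _ _)] at h
  simp only [Pi.mul_apply, hg.eq_zero (x := 0) (by simp), hg.eq_zero (x := 1) (by simp), zero_mul,
    sub_zero] at h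
  unfold unitLaplace
  rw [eq_neg_of_add_eq_zero_left h, ← intervalIntegral.integral_const_mul]
  congr 1
  refine intervalIntegral.integral_congr fun x _ => ?_
  ring

/-- Multiplication by `z` is differentiation of `g`, up to sign. The induction therefore needs the
previous power for both `g` and `deriv g`, hence the quantifier over `g` inside. -/
theorem unitLaplace_decay (p : ℕ) : ∀ {g : ℝ → ℂ}, IsUnitBump g →
    ∃ C : ℝ, 0 ≤ C ∧ ∀ z : ℂ, 0 ≤ z.re →
      (1 + ‖z‖) ^ p * ‖unitLaplace g z‖ ≤ C * Real.exp z.re := by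
  induction p with
  | zero =>
    intro g hg
    have hc := hg.smooth.continuous
    refine ⟨∫ x in (0 : ℝ)..1, ‖g x‖,
      intervalIntegral.integral_nonneg zero_le_one fun _ _ => norm_nonneg _, fun z hz => ?_⟩
    rw [pow_zero, one_mul, ← intervalIntegral.integral_mul_const]
    refine intervalIntegral.norm_integral_le_of_norm_le zero_le_one
      (Eventually.of_forall fun x hx => ?_) (Continuous.intervalIntegrable (by fun_prop) _ _)
    rw [norm_mul, Complex.norm_exp]
    refine mul_le_mul_of_nonneg_left (Real.exp_le_exp.mpr ?_) (norm_nonneg _)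
    rw [Complex.re_mul_ofReal]
    exact mul_le_of_le_one_right hz hx.2
  | succ p ih =>
    intro g hg
    obtain ⟨C, hC, h⟩ := ih hg
    obtain ⟨C', hC', h'⟩ := ih hg.deriv
    refine ⟨C + C', by positivity, fun z hz => ?_⟩
    have h1 := h' z hz
    rw [unitLaplace_deriv hg, norm_neg, norm_mul] at h1
    calc (1 + ‖z‖) ^ (p + 1) * ‖unitLaplace g z‖
        = (1 + ‖z‖) ^ p * ‖unitLaplace g z‖ + (1 + ‖z‖) ^ p * (‖z‖ * ‖unitLaplace g z‖) := by ring
      _ ≤ _ := by rw [add_mul]; exact add_le_add (h z hz) h1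

/-- The smooth step from `1` to `0` with derivative `-g`. -/
noncomputable def unitStep (g : ℝ → ℂ) (t : ℝ) : ℂ := 1 - ∫ x in (0 : ℝ)..t, g x

theorem unitStep_of_nonpos {g : ℝ → ℂ} (hg : IsUnitBump g) {t : ℝ} (ht : t ≤ 0) :
    unitStep g t = 1 := by
  have : ∫ x in (0 : ℝ)..t, g x = 0 := by
    refine (intervalIntegral.integral_congr fun x hx => ?_).trans intervalIntegral.integral_zero
    rw [Set.uIcc_of_ge ht] at hx
    exact hg.eq_zero fun h => absurd h.1 (not_lt.mpr hx.2)
  rw [unitStep, this, sub_zero]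

theorem unitStep_of_one_le {g : ℝ → ℂ} (hg : IsUnitBump g) (h1 : ∫ x in (0 : ℝ)..1, g x = 1)
    {t : ℝ} (ht : 1 ≤ t) : unitStep g t = 0 := by
  have hc := hg.smooth.continuous
  have : ∫ x in (1 : ℝ)..t, g x = 0 := by
    refine (intervalIntegral.integral_congr fun x hx => ?_).trans intervalIntegral.integral_zero
    rw [Set.uIcc_of_le ht] at hx
    exact hg.eq_zero fun h => absurd h.2 (not_lt.mpr hx.1)
  rw [unitStep, ← intervalIntegral.integral_add_adjacent_intervals (hc.intervalIntegrable 0 1)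
    (hc.intervalIntegrable 1 t), this, h1, add_zero, sub_self]

theorem hasDerivAt_unitStep {g : ℝ → ℂ} (hg : IsUnitBump g) (t : ℝ) :
    HasDerivAt (unitStep g) (-g t) t := by
  have hc := hg.smooth.continuous
  exact (intervalIntegral.integral_hasDerivAt_right (hc.intervalIntegrable 0 t)
    (hc.stronglyMeasurableAtFilter _ _) hc.continuousAt).const_sub 1

theorem continuous_unitStep {g : ℝ → ℂ} (hg : IsUnitBump g) : Continuous (unitStep g) :=
  continuous_iff_continuousAt.mpr fun t => (hasDerivAt_unitStep hg t).continuousAt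

theorem integrable_unitStep_mul_exp {g : ℝ → ℂ} (hg : IsUnitBump g)
    (h1 : ∫ x in (0 : ℝ)..1, g x = 1) {z : ℂ} (hz : 0 < z.re) :
    MeasureTheory.Integrable fun x : ℝ => unitStep g x * Complex.exp (z * x) := by
  have hc : Continuous fun x : ℝ => unitStep g x * Complex.exp (z * x) :=
    (continuous_unitStep hg).mul (by fun_prop)
  rw [← MeasureTheory.integrableOn_univ, ← Set.Iic_union_Ioi (a := (1 : ℝ)),
    ← Set.Iic_union_Ioc_eq_Iic zero_le_one]
  refine (MeasureTheory.IntegrableOn.union ?_ ?_).union ?_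
  · have h := integrableOn_exp_mul_complex_Iic hz 0
    refine h.congr_fun (fun x hx => ?_) measurableSet_Iic
    simp only
    rw [unitStep_of_nonpos hg hx, one_mul]
  · exact (hc.integrableOn_Icc (a := 0) (b := 1)).mono_set Set.Ioc_subset_Icc_self
  · refine MeasureTheory.integrableOn_zero.congr_fun (fun x hx => ?_) measurableSet_Ioi
    simp only
    rw [unitStep_of_one_le hg h1 (le_of_lt hx), zero_mul]

/-- Integration by parts on the whole line: the integrable function `unitStep g x * e^{zx}` has an
integrable derivative, whose integral is `0`. -/
theorem integral_unitStep_mul_exp {g : ℝ → ℂ} (hg : IsUnitBump g)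
    (h1 : ∫ x in (0 : ℝ)..1, g x = 1) {z : ℂ} (hz : 0 < z.re) :
    ∫ x : ℝ, unitStep g x * Complex.exp (z * x) = unitLaplace g z / z := by
  have hz0 : z ≠ 0 := by
    rintro rfl
    simp at hz
  have hc := hg.smooth.continuous
  have hint := integrable_unitStep_mul_exp hg h1 hz
  have hsupp : Function.support (fun x : ℝ => g x * Complex.exp (z * x)) ⊆ Set.Ioc 0 1 := by
    intro x hx
    by_contra h
    exact hx (by simp [hg.eq_zero fun h' => h (Set.Ioo_subset_Ioc_self h')])
  have hgint : MeasureTheory.Integrable fun x : ℝ => g x * Complex.exp (z * x) := by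
    refine (Continuous.integrable_of_hasCompactSupport (by fun_prop) ?_)
    refine HasCompactSupport.intro (K := Set.Icc 0 1) isCompact_Icc fun x hx => ?_
    rw [hg.eq_zero fun h' => hx (Set.Ioo_subset_Icc_self h'), zero_mul]
  have hd : ∀ x : ℝ, HasDerivAt (fun x : ℝ => unitStep g x * Complex.exp (z * x))
      (z * (unitStep g x * Complex.exp (z * x)) - g x * Complex.exp (z * x)) x := by
    intro x
    have h := (hasDerivAt_unitStep hg x).mul
      (((hasDerivAt_id (x : ℂ)).const_mul z).cexp).comp_ofReal
    refine h.congr_deriv ?_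
    simp only [id]
    ring
  have h := MeasureTheory.integral_eq_zero_of_hasDerivAt_of_integrable hd
    ((hint.const_mul z).sub hgint) hint
  rw [MeasureTheory.integral_sub (hint.const_mul z) hgint, MeasureTheory.integral_const_mul,
    sub_eq_zero] at h
  rw [eq_div_iff hz0, mul_comm, h, unitLaplace,
    intervalIntegral.integral_eq_integral_of_support_subset hsupp]

/-! ### The kernel of a smooth step: decay and Perron's formula -/

/-- The two-sided Laplace transform of the smooth step from `α` to `α + h`. -/
noncomputable def stepKernel (g : ℝ → ℂ) (α h : ℝ) (s : ℂ) : ℂ :=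
  unitLaplace g (h * s) / s * Complex.exp (α * s)

theorem stepKernel_zero_one (g : ℝ → ℂ) (s : ℂ) : stepKernel g 0 1 s = unitLaplace g s / s := by
  simp [stepKernel]

theorem differentiableOn_stepKernel {g : ℝ → ℂ} (hg : IsUnitBump g) (α h : ℝ) :
    DifferentiableOn ℂ (stepKernel g α h) {s : ℂ | 0 < s.re} := by
  have hU := differentiable_unitLaplace hg.smooth.continuous
  refine DifferentiableOn.mul (DifferentiableOn.div ?_ differentiableOn_id ?_) ?_
  · exact (hU.comp (differentiable_id.const_mul (h : ℂ))).differentiableOn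
  · rintro s hs rfl
    simp at hs
  · exact ((differentiable_id.const_mul (α : ℂ)).cexp).differentiableOn

/-- On vertical strips the kernel decays faster than any power. -/
theorem stepKernel_decay {g : ℝ → ℂ} (hg : IsUnitBump g) (p : ℕ) {α h : ℝ} (hα : 0 ≤ α)
    (hh : 0 < h) {c : ℝ} (d : ℝ) (hc : 0 < c) :
    ∃ C : ℝ, 0 ≤ C ∧ ∀ s : ℂ, c ≤ s.re → s.re ≤ d →
      (1 + ‖s‖) ^ p * ‖stepKernel g α h s‖ ≤ C * (1 + s.im ^ 2)⁻¹ := by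
  -- The two extra powers pay for the integrable factor `(1 + s.im ^ 2)⁻¹`.
  obtain ⟨C, hC, hdec⟩ := unitLaplace_decay (p + 2) hg
  refine ⟨(1 + 1 / h) ^ (p + 2) * (C * Real.exp (h * d)) * Real.exp (α * d) / c, by positivity,
    fun s hs hs' => ?_⟩
  have hre : ((h : ℂ) * s).re = h * s.re := by simp
  have h1 := hdec (h * s) (by rw [hre]; exact mul_nonneg hh.le (hc.le.trans hs))
  rw [hre, norm_mul, Complex.norm_real, Real.norm_of_nonneg hh.le] at h1
  have h2 : c ≤ ‖s‖ := hs.trans (Complex.re_le_norm s)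
  have h3 : 0 < ‖s‖ := hc.trans_le h2
  have h4 : 1 + s.im ^ 2 ≤ (1 + ‖s‖) ^ 2 := by
    have := Complex.abs_im_le_norm s
    nlinarith [sq_abs s.im, abs_nonneg s.im]
  have h5 : 0 < 1 + s.im ^ 2 := by positivity
  have h6 : 1 + ‖s‖ ≤ (1 + 1 / h) * (1 + h * ‖s‖) := by
    have : (1 + 1 / h) * (1 + h * ‖s‖) = 1 + ‖s‖ + (1 / h + h * ‖s‖) := by field_simp; ring
    rw [this]
    linarith [show 0 ≤ 1 / h + h * ‖s‖ by positivity]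
  have h7 : ‖Complex.exp (α * s)‖ ≤ Real.exp (α * d) := by
    rw [Complex.norm_exp, Complex.re_ofReal_mul]
    gcongr
  have h8 : Real.exp (h * s.re) ≤ Real.exp (h * d) := by gcongr
  rw [stepKernel, norm_mul, norm_div, ← div_eq_mul_inv, le_div_iff₀ h5, ← mul_assoc,
    ← mul_div_assoc, div_mul_eq_mul_div, div_mul_eq_mul_div, div_le_div_iff₀ h3 hc]
  calc (1 + ‖s‖) ^ p * ‖unitLaplace g (h * s)‖ * ‖Complex.exp (α * s)‖ * (1 + s.im ^ 2) * c
      ≤ (1 + ‖s‖) ^ p * ‖unitLaplace g (h * s)‖ * Real.exp (α * d) * (1 + ‖s‖) ^ 2 * ‖s‖ := by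
        gcongr
    _ = (1 + ‖s‖) ^ (p + 2) * ‖unitLaplace g (h * s)‖ * Real.exp (α * d) * ‖s‖ := by ring
    _ ≤ ((1 + 1 / h) * (1 + h * ‖s‖)) ^ (p + 2) * ‖unitLaplace g (h * s)‖
          * Real.exp (α * d) * ‖s‖ := by gcongr
    _ = (1 + 1 / h) ^ (p + 2) * ((1 + h * ‖s‖) ^ (p + 2) * ‖unitLaplace g (h * s)‖)
          * Real.exp (α * d) * ‖s‖ := by rw [mul_pow]; ring
    _ ≤ (1 + 1 / h) ^ (p + 2) * (C * Real.exp (h * d)) * Real.exp (α * d) * ‖s‖ := by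
        have := h1.trans (mul_le_mul_of_nonneg_left h8 hC)
        gcongr

theorem continuous_comp_vertical {Φ : ℂ → ℂ} (hΦ : DifferentiableOn ℂ Φ {s : ℂ | 0 < s.re})
    {c : ℝ} (hc : 0 < c) : Continuous fun y : ℝ => Φ (c + y * Complex.I) :=
  hΦ.continuousOn.comp_continuous (by fun_prop) fun y => by simpa using hc

theorem integrable_vertical {Φ : ℂ → ℂ} (hΦ : DifferentiableOn ℂ Φ {s : ℂ | 0 < s.re})
    {c C : ℝ} (hc : 0 < c) (hb : ∀ s : ℂ, c ≤ s.re → s.re ≤ c → ‖Φ s‖ ≤ C * (1 + s.im ^ 2)⁻¹) :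
    MeasureTheory.Integrable fun y : ℝ => Φ (c + y * Complex.I) := by
  refine (integrable_inv_one_add_sq.const_mul C).mono'
    (continuous_comp_vertical hΦ hc).aestronglyMeasurable (Eventually.of_forall fun y => ?_)
  simpa using hb (c + y * Complex.I) (by simp) (by simp)

theorem integrable_stepKernel_vertical {g : ℝ → ℂ} (hg : IsUnitBump g) {α h : ℝ} (hα : 0 ≤ α)
    (hh : 0 < h) {c : ℝ} (hc : 0 < c) :
    MeasureTheory.Integrable fun y : ℝ => stepKernel g α h (c + y * Complex.I) := by
  obtain ⟨C, _, hC⟩ := stepKernel_decay hg 0 hα hh c hc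
  exact integrable_vertical (differentiableOn_stepKernel hg α h) hc
    fun s hs hs' => by simpa using hC s hs hs'

/-- Perron's formula for the smooth step. -/
theorem integral_unitLaplace_perron {g : ℝ → ℂ} (hg : IsUnitBump g)
    (h1 : ∫ x in (0 : ℝ)..1, g x = 1) {c : ℝ} (hc : 0 < c) (t : ℝ) :
    ∫ y : ℝ, unitLaplace g (c + y * Complex.I) / (c + y * Complex.I)
      * Complex.exp (-t * (c + y * Complex.I)) = 2 * Real.pi * unitStep g t := by
  -- The weight `e^{cx}` makes the step integrable at `-∞`. Its Fourier transform at `ξ` is the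
  -- kernel at `c - 2πiξ`, so the formula is Fourier inversion at the point `t`, which holds
  -- pointwise since `v` is continuous.
  set v : ℝ → ℂ := fun x => unitStep g x * Complex.exp (c * x) with hv
  have hvint : MeasureTheory.Integrable v :=
    integrable_unitStep_mul_exp hg h1 (by simpa using hc)
  have hF : FourierTransform.fourier v = fun ξ : ℝ =>
      unitLaplace g (c + ((-2 * Real.pi * ξ : ℝ) : ℂ) * Complex.I)
        / (c + ((-2 * Real.pi * ξ : ℝ) : ℂ) * Complex.I) := by
    funext ξ
    rw [Real.fourier_eq', ← integral_unitStep_mul_exp hg h1 (by simpa using hc)]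
    refine MeasureTheory.integral_congr_ae (Eventually.of_forall fun x => ?_)
    simp only [hv, smul_eq_mul, RCLike.inner_apply, conj_trivial]
    rw [mul_left_comm, ← Complex.exp_add]
    congr 2
    push_cast
    ring
  have hFint : MeasureTheory.Integrable (FourierTransform.fourier v) := by
    rw [hF]
    have hi := integrable_stepKernel_vertical hg le_rfl one_pos hc
    simp only [stepKernel_zero_one] at hi
    exact hi.comp_mul_left' (by
      simp [Real.pi_ne_zero] : (-2 * Real.pi : ℝ) ≠ 0)
  have hcont : ContinuousAt v t :=
    ((continuous_unitStep hg).mul (by fun_prop)).continuousAt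
  have hinv := hvint.fourierInv_fourier_eq hFint hcont
  rw [hF, Real.fourierInv_eq'] at hinv
  have hcomp := MeasureTheory.Measure.integral_comp_mul_left (fun y : ℝ =>
    unitLaplace g (c + y * Complex.I) / (c + y * Complex.I)
      * Complex.exp (-t * (c + y * Complex.I))) (-2 * Real.pi)
  have habs : |(-2 * Real.pi)⁻¹| = (2 * Real.pi)⁻¹ := by
    rw [neg_mul, inv_neg, abs_neg, abs_of_pos (by positivity)]
  rw [habs, eq_inv_smul_iff₀ (by positivity)] at hcomp
  rw [← hcomp]
  have hint : ∫ x : ℝ, unitLaplace g (c + ((-2 * Real.pi * x : ℝ) : ℂ) * Complex.I)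
      / (c + ((-2 * Real.pi * x : ℝ) : ℂ) * Complex.I)
      * Complex.exp (-t * (c + ((-2 * Real.pi * x : ℝ) : ℂ) * Complex.I)) = unitStep g t := by
    have h2 : unitStep g t = Complex.exp (-(c * t)) * v t := by
      rw [hv]
      simp only
      rw [mul_left_comm, ← Complex.exp_add, neg_add_cancel, Complex.exp_zero, mul_one]
    rw [h2, ← hinv, ← MeasureTheory.integral_const_mul]
    refine MeasureTheory.integral_congr_ae (Eventually.of_forall fun x => ?_)
    simp only [smul_eq_mul, RCLike.inner_apply, conj_trivial]
    rw [← mul_assoc, ← Complex.exp_add, mul_comm]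
    congr 2
    push_cast
    ring
  rw [hint, Complex.real_smul]
  push_cast
  ring

/-- The substitution `y ↦ h y` reduces this to the unit step on the line `Re = h c`. -/
theorem integral_stepKernel_perron {g : ℝ → ℂ} (hg : IsUnitBump g)
    (h1 : ∫ x in (0 : ℝ)..1, g x = 1) (α : ℝ) {h c : ℝ} (hh : 0 < h) (hc : 0 < c) (t : ℝ) :
    ∫ y : ℝ, stepKernel g α h (c + y * Complex.I) * Complex.exp (-t * (c + y * Complex.I))
      = 2 * Real.pi * unitStep g ((t - α) / h) := by
  have hhc : (h : ℂ) ≠ 0 := by exact_mod_cast hh.ne'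
  rw [← integral_unitLaplace_perron hg h1 (mul_pos hh hc) ((t - α) / h)]
  have hcomp := MeasureTheory.Measure.integral_comp_mul_left (fun y : ℝ =>
    unitLaplace g (((h * c : ℝ) : ℂ) + y * Complex.I) / (((h * c : ℝ) : ℂ) + y * Complex.I)
      * Complex.exp (-(((t - α) / h : ℝ) : ℂ) * (((h * c : ℝ) : ℂ) + y * Complex.I))) h
  rw [abs_of_pos (inv_pos.mpr hh), eq_inv_smul_iff₀ hh.ne'] at hcomp
  rw [← hcomp, Complex.real_smul, ← MeasureTheory.integral_const_mul]
  refine MeasureTheory.integral_congr_ae (Eventually.of_forall fun y => ?_)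
  simp only
  set s : ℂ := c + y * Complex.I with hs
  have e1 : ((h * c : ℝ) : ℂ) + ((h * y : ℝ) : ℂ) * Complex.I = h * s := by
    rw [hs]; push_cast; ring
  have e2 : -(((t - α) / h : ℝ) : ℂ) * (h * s) = α * s + -t * s := by
    push_cast
    field_simp
    ring
  have hs0 : s ≠ 0 := by
    intro h0
    have := congrArg Complex.re h0
    simp [hs] at this
    exact hc.ne' this
  rw [e1, e2, Complex.exp_add, stepKernel]
  field_simp

/-! ### Shifting vertical lines of integration -/

theorem integral_vertical_eq {Φ : ℂ → ℂ} {c d C : ℝ} (hc : 0 < c) (hcd : c ≤ d)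
    (hΦ : DifferentiableOn ℂ Φ {s : ℂ | 0 < s.re})
    (hb : ∀ s : ℂ, c ≤ s.re → s.re ≤ d → ‖Φ s‖ ≤ C * (1 + s.im ^ 2)⁻¹) :
    ∫ y : ℝ, Φ (c + y * Complex.I) = ∫ y : ℝ, Φ (d + y * Complex.I) := by
  have hci := integrable_vertical (C := C) hΦ hc fun s h h' => hb s h (h'.trans hcd)
  have hdi := integrable_vertical (C := C) hΦ (hc.trans_le hcd) fun s h h' => hb s (hcd.trans h) h'
  have hrect : ∀ T : ℝ, ((∫ x in c..d, Φ (x + ((-T : ℝ) : ℂ) * Complex.I))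
      - ∫ x in c..d, Φ (x + (T : ℂ) * Complex.I))
      + Complex.I • (∫ y in (-T)..T, Φ (d + y * Complex.I))
      - Complex.I • (∫ y in (-T)..T, Φ (c + y * Complex.I)) = 0 := by
    intro T
    have h := Complex.integral_boundary_rect_eq_zero_of_differentiableOn Φ ⟨c, -T⟩ ⟨d, T⟩
      (hΦ.mono fun s hs => ?_)
    · exact h
    · rw [Complex.mem_reProdIm, Set.uIcc_of_le hcd] at hs
      exact hc.trans_le hs.1.1
  have htop : Tendsto (fun T : ℝ => C * (1 + T ^ 2)⁻¹ * |d - c|) atTop (𝓝 0) := by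
    have h1 : Tendsto (fun T : ℝ => 1 + T ^ 2) atTop atTop :=
      tendsto_atTop_add_const_left _ _ (tendsto_pow_atTop two_ne_zero)
    simpa using (h1.inv_tendsto_atTop.const_mul C).mul_const |d - c|
  -- The values `ε = ±1` treat both horizontal sides of the rectangle at once.
  have hhor : ∀ ε : ℝ, ε ^ 2 = 1 → Tendsto
      (fun T : ℝ => ∫ x in c..d, Φ (x + ((ε * T : ℝ) : ℂ) * Complex.I)) atTop (𝓝 0) := by
    intro ε hε
    refine squeeze_zero_norm (fun T => ?_) htop
    refine intervalIntegral.norm_integral_le_of_norm_le_const fun x hx => ?_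
    rw [Set.uIoc_of_le hcd] at hx
    have h := hb (x + ((ε * T : ℝ) : ℂ) * Complex.I) (by simpa using hx.1.le) (by simpa using hx.2)
    have him : ((x : ℂ) + ((ε * T : ℝ) : ℂ) * Complex.I).im = ε * T := by simp
    rwa [him, mul_pow, hε, one_mul] at h
  have hm := hhor (-1) (by norm_num)
  have hp := hhor 1 (by norm_num)
  simp only [neg_mul, one_mul] at hm hp
  have hd' := MeasureTheory.intervalIntegral_tendsto_integral hdi tendsto_neg_atTop_atBot
    tendsto_id
  have hc' := MeasureTheory.intervalIntegral_tendsto_integral hci tendsto_neg_atTop_atBot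
    tendsto_id
  have hlim := ((hm.sub hp).add (hd'.const_smul Complex.I)).sub (hc'.const_smul Complex.I)
  have hzero := tendsto_nhds_unique (hlim.congr hrect) tendsto_const_nhds
  rw [sub_zero, zero_add, ← smul_sub, smul_eq_zero, sub_eq_zero] at hzero
  exact (hzero.resolve_left Complex.I_ne_zero).symm

/-! ### Partial sums of the coefficients of a Riesz germ -/

/-- The operator argument for vertical growth needs an integer order; raising `m` with `p = ⌈m⌉ - m`
reaches `⌈m⌉ + 1`. -/
theorem IsRieszGerm.exists_nat_order {lam : Frequency} {a : ℕ → ℂ} {f : RHP → ℂ}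
    (h : IsRieszGerm lam a f) : ∃ m : ℕ, ∃ σ : ℝ, ∀ s : RHP, σ < (s : ℂ).re →
      Tendsto (fun x : ℝ => rieszMean lam m a s x) atTop (𝓝 (f s)) := by
  obtain ⟨m, hm, σ, hσ⟩ := h
  refine ⟨⌈m⌉₊ + 1, σ, fun s hs => ?_⟩
  have h1 := rieszMean_raise lam hm (sub_nonneg.mpr (Nat.le_ceil m)) a s _ (hσ s hs)
  rwa [add_sub_cancel, ← Nat.cast_add_one] at h1

/-- Perron's formula for each term: the step is `1` at `λ_n` for `n ≤ N` and `0` for `n > N`, as no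
frequency falls inside the transition. -/
theorem integral_rieszMean_stepKernel {g : ℝ → ℂ} (hg : IsUnitBump g)
    (h1 : ∫ x in (0 : ℝ)..1, g x = 1) (lam : Frequency) (N m : ℕ) (a : ℕ → ℂ) {c : ℝ}
    (hc : 0 < c) {x : ℝ} (hx : lam (N + 1) ≤ x) :
    ∫ y : ℝ, rieszMean lam m a (c + y * Complex.I) x
        * stepKernel g (lam N) (lam (N + 1) - lam N) (c + y * Complex.I)
      = 2 * Real.pi * ∑ n ∈ Finset.range (N + 1), a n * (((1 - lam n / x) ^ m : ℝ) : ℂ) := by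
  have hh : 0 < lam (N + 1) - lam N := sub_pos.mpr (lam.strictMono' (Nat.lt_succ_self N))
  set α := lam N
  set h := lam (N + 1) - lam N with hhdef
  have hκ := integrable_stepKernel_vertical hg (lam.nonneg' N) hh hc
  have hint : ∀ n, MeasureTheory.Integrable fun y : ℝ => (a n * (((1 - lam n / x) ^ m : ℝ) : ℂ)) *
      (stepKernel g α h (c + y * Complex.I)
        * Complex.exp (-(lam n : ℂ) * (c + y * Complex.I))) := by
    intro n
    refine MeasureTheory.Integrable.const_mul ?_ _
    refine hκ.mul_bdd (c := Real.exp (-lam n * c)) (Continuous.aestronglyMeasurable (by fun_prop))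
      (Eventually.of_forall fun y => ?_)
    rw [Complex.norm_exp]
    simp
  have hsum : ∀ y : ℝ, rieszMean lam m a (c + y * Complex.I) x
      * stepKernel g α h (c + y * Complex.I)
      = ∑ n ∈ lam.below x, (a n * (((1 - lam n / x) ^ m : ℝ) : ℂ)) *
        (stepKernel g α h (c + y * Complex.I)
          * Complex.exp (-(lam n : ℂ) * (c + y * Complex.I))) := by
    intro y
    rw [rieszMean, Finset.sum_mul]
    refine Finset.sum_congr rfl fun n _ => ?_
    rw [Real.rpow_natCast]
    ring
  simp_rw [hsum]
  rw [MeasureTheory.integral_finsetSum _ fun n _ => hint n]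
  simp_rw [MeasureTheory.integral_const_mul, integral_stepKernel_perron hg h1 α hh hc]
  have hsub : Finset.range (N + 1) ⊆ lam.below x := by
    intro n hn
    rw [Frequency.mem_below]
    exact (lam.strictMono' (Finset.mem_range.mp hn)).trans_le hx
  rw [← Finset.sum_subset hsub, Finset.mul_sum]
  · refine Finset.sum_congr rfl fun n hn => ?_
    have hle : lam n ≤ α := lam.strictMono'.monotone (Nat.lt_succ_iff.mp (Finset.mem_range.mp hn))
    rw [unitStep_of_nonpos hg (div_nonpos_of_nonpos_of_nonneg (sub_nonpos.mpr hle) hh.le)]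
    ring
  · intro n _ hn
    have hle : lam (N + 1) ≤ lam n :=
      lam.strictMono'.monotone (not_lt.mp fun h' => hn (Finset.mem_range.mpr h'))
    rw [unitStep_of_one_le hg h1 ((one_le_div hh).mpr (by rw [hhdef]; linarith))]
    ring

/-- On a vertical line far to the right, the partial sums of the coefficients are integrals of
the limit function against the kernel. -/
theorem integral_germ_stepKernel_right {g : ℝ → ℂ} (hg : IsUnitBump g)
    (h1 : ∫ x in (0 : ℝ)..1, g x = 1) (lam : Frequency) (N m : ℕ) {a : ℕ → ℂ} {F : ℂ → ℂ}
    {σ d : ℝ} (hσ : 0 ≤ σ) (hd : σ < d)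
    (hlim : ∀ s : ℂ, σ < s.re → Tendsto (fun x : ℝ => rieszMean lam m a s x) atTop (𝓝 (F s))) :
    ∫ y : ℝ, F (d + y * Complex.I)
        * stepKernel g (lam N) (lam (N + 1) - lam N) (d + y * Complex.I)
      = 2 * Real.pi * ∑ n ∈ Finset.range (N + 1), a n := by
  have hh : 0 < lam (N + 1) - lam N := sub_pos.mpr (lam.strictMono' (Nat.lt_succ_self N))
  have hd0 : 0 < d := hσ.trans_lt hd
  -- The point `s₀ = d - r` lies midway between `σ` and `d`: still in the region of convergence,
  -- with the line `Re s = d` at distance `r` to its right.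
  set r : ℝ := (d - σ) / 2 with hr
  have hr0 : 0 < r := by rw [hr]; linarith
  set s₀ : ℂ := ((d - r : ℝ) : ℂ) with hs₀
  obtain ⟨K, hK⟩ := rieszMean_bounded lam (Nat.cast_nonneg m) a s₀ _
    (hlim s₀ (by rw [hs₀, Complex.ofReal_re, hr]; linarith))
  obtain ⟨K', hK'⟩ := rieszMean_vertical_bound lam m a s₀ hK hr0
  have hK'0 : 0 ≤ K' := by
    have h := (norm_nonneg _).trans (hK' r (Complex.ofReal_re r) 1 le_rfl)
    exact nonneg_of_mul_nonneg_left h (by positivity)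
  -- The exponent `m + 1` matches the growth of the Riesz means, so their product with the kernel
  -- has an integrable majorant independent of `x`.
  obtain ⟨C, hC, hdec⟩ := stepKernel_decay hg (m + 1) (lam.nonneg' N) hh d hd0
  have hconv : Tendsto (fun x : ℝ => ∫ y : ℝ, rieszMean lam m a (d + y * Complex.I) x
        * stepKernel g (lam N) (lam (N + 1) - lam N) (d + y * Complex.I)) atTop
      (𝓝 (∫ y : ℝ, F (d + y * Complex.I)
        * stepKernel g (lam N) (lam (N + 1) - lam N) (d + y * Complex.I))) := by
    refine MeasureTheory.tendsto_integral_filter_of_dominated_convergence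
      (fun y => K' * (C * (1 + y ^ 2)⁻¹)) ?_ ?_
      ((integrable_inv_one_add_sq.const_mul C).const_mul K') ?_
    · refine Eventually.of_forall fun x => Continuous.aestronglyMeasurable ?_
      refine Continuous.mul ?_
        (continuous_comp_vertical (differentiableOn_stepKernel hg _ _) hd0)
      unfold rieszMean
      fun_prop
    · filter_upwards [eventually_ge_atTop 1] with x hx
      refine Eventually.of_forall fun y => ?_
      set s : ℂ := d + y * Complex.I with hs
      have hw : s = s₀ + (r + y * Complex.I) := by
        rw [hs, hs₀]; push_cast; ring
      have hb := hK' (r + y * Complex.I) (by simp) x hx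
      rw [← hw] at hb
      have hle : ‖(r : ℂ) + y * Complex.I‖ ≤ ‖s‖ := by
        rw [hs, Complex.norm_add_mul_I, Complex.norm_add_mul_I]
        refine Real.sqrt_le_sqrt ?_
        have : r ≤ d := by rw [hr]; linarith
        gcongr
      have hk := hdec s (by simp [hs]) (by simp [hs])
      have him : s.im = y := by simp [hs]
      rw [him] at hk
      rw [norm_mul]
      calc ‖rieszMean lam m a s x‖ * ‖stepKernel g (lam N) (lam (N + 1) - lam N) s‖
          ≤ K' * (1 + ‖s‖) ^ (m + 1) * ‖stepKernel g (lam N) (lam (N + 1) - lam N) s‖ := by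
            refine mul_le_mul_of_nonneg_right (hb.trans ?_) (norm_nonneg _)
            gcongr
        _ = K' * ((1 + ‖s‖) ^ (m + 1) * ‖stepKernel g (lam N) (lam (N + 1) - lam N) s‖) := by ring
        _ ≤ _ := by gcongr
    · exact Eventually.of_forall fun y => (hlim _ (by simpa using hd)).mul_const _
  have hsum : Tendsto (fun x : ℝ => 2 * (Real.pi : ℂ) *
      ∑ n ∈ Finset.range (N + 1), a n * (((1 - lam n / x) ^ m : ℝ) : ℂ)) atTop
      (𝓝 (2 * Real.pi * ∑ n ∈ Finset.range (N + 1), a n)) := by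
    refine (tendsto_finsetSum _ fun n _ => ?_).const_mul _
    have h2 : Tendsto (fun x : ℝ => (1 - lam n / x) ^ m) atTop (𝓝 1) := by
      simpa using ((tendsto_const_nhds (x := lam n)).div_atTop tendsto_id |>.const_sub 1).pow m
    simpa using ((Complex.continuous_ofReal.tendsto _).comp h2).const_mul (a n)
  refine tendsto_nhds_unique hconv (hsum.congr' ?_)
  filter_upwards [eventually_ge_atTop (lam (N + 1))] with x hx
  exact (integral_rieszMean_stepKernel hg h1 lam N m a hd0 hx).symm

/-- The identity is known far to the right; the line can be moved to any `c > 0` because the kernel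
outweighs the growth of order `⌈l⌉₊` in the whole strip. -/
theorem integral_germ_stepKernel {g : ℝ → ℂ} (hg : IsUnitBump g)
    (h1 : ∫ x in (0 : ℝ)..1, g x = 1) (lam : Frequency) (N : ℕ) {a : ℕ → ℂ} {f : RHP → ℂ}
    (ha : IsRieszGerm lam a f) {F : ℂ → ℂ} (hF : DifferentiableOn ℂ F {s : ℂ | 0 < s.re})
    (hFf : ∀ s : RHP, F s = f s) {l A : ℝ} (hA : 0 ≤ A)
    (hb : ∀ s : RHP, ‖f s‖ ≤ A * (1 + ‖(s : ℂ)‖) ^ l) {c : ℝ} (hc : 0 < c) :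
    ∫ y : ℝ, F (c + y * Complex.I)
        * stepKernel g (lam N) (lam (N + 1) - lam N) (c + y * Complex.I)
      = 2 * Real.pi * ∑ n ∈ Finset.range (N + 1), a n := by
  have hh : 0 < lam (N + 1) - lam N := sub_pos.mpr (lam.strictMono' (Nat.lt_succ_self N))
  obtain ⟨m, σ, hlim⟩ := ha.exists_nat_order
  set d : ℝ := max (max σ 0) c + 1 with hd
  have hcd : c ≤ d := by rw [hd]; linarith [le_max_right (max σ 0) c]
  have hσd : max σ 0 < d := by rw [hd]; linarith [le_max_left (max σ 0) c]
  rw [← integral_germ_stepKernel_right hg h1 lam N m (a := a) (F := F) (le_max_right σ 0) hσd]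
  · obtain ⟨C, hC, hdec⟩ := stepKernel_decay hg ⌈l⌉₊ (lam.nonneg' N) hh d hc
    refine integral_vertical_eq (C := A * C) hc hcd
      (Φ := fun s => F s * stepKernel g (lam N) (lam (N + 1) - lam N) s)
      (hF.mul (differentiableOn_stepKernel hg _ _)) fun s hs hs' => ?_
    have h2 : ‖F s‖ ≤ A * (1 + ‖s‖) ^ ⌈l⌉₊ := by
      have h3 := hb ⟨s, hc.trans_le hs⟩
      rw [← hFf ⟨s, hc.trans_le hs⟩] at h3
      refine h3.trans (mul_le_mul_of_nonneg_left ?_ hA)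
      rw [← Real.rpow_natCast]
      exact Real.rpow_le_rpow_of_exponent_le (by simp) (Nat.le_ceil l)
    rw [norm_mul]
    calc ‖F s‖ * ‖stepKernel g (lam N) (lam (N + 1) - lam N) s‖
        ≤ A * (1 + ‖s‖) ^ ⌈l⌉₊ * ‖stepKernel g (lam N) (lam (N + 1) - lam N) s‖ := by gcongr
      _ = A * ((1 + ‖s‖) ^ ⌈l⌉₊ * ‖stepKernel g (lam N) (lam (N + 1) - lam N) s‖) := by ring
      _ ≤ A * (C * (1 + s.im ^ 2)⁻¹) := mul_le_mul_of_nonneg_left (hdec s hs hs') hA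
      _ = _ := by ring
  · intro s hs
    have := hlim ⟨s, (le_max_right σ 0).trans_lt hs⟩ ((le_max_left σ 0).trans_lt hs)
    rwa [← hFf] at this

/-! ### The estimate of partial sums on a well-chosen line -/

/-- Write `|s| = c q` with `q = (1 + (y/c)²)^{1/2} ≥ 1`. The growth weight contributes at most `(1 +
c)^l q^l`, the decay of the Laplace transform `(h c q)^{-k}` and the denominator `(c q)^{-1}`, in
total `q^{l-k-1}`. -/
theorem stepKernel_line_bound {g : ℝ → ℂ} {C k l : ℝ} (hk : 0 ≤ k)
    (hl : 0 ≤ l) (hU : ∀ z : ℂ, 0 ≤ z.re →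
      (1 + ‖z‖) ^ ⌈k⌉₊ * ‖unitLaplace g z‖ ≤ C * Real.exp z.re)
    {α h c : ℝ} (hh : 0 < h) (hc : 0 < c) (y : ℝ) :
    (1 + ‖(c : ℂ) + y * Complex.I‖) ^ l * ‖stepKernel g α h (c + y * Complex.I)‖
      ≤ C * Real.exp ((α + h) * c) * ((1 + c) ^ l * (c * h) ^ (-k) / c)
        * (1 + ‖c⁻¹ * y‖ ^ 2) ^ (-(k + 1 - l) / 2) := by
  set s : ℂ := c + y * Complex.I with hs
  set Q : ℝ := 1 + ‖c⁻¹ * y‖ ^ 2 with hQ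
  have hQ0 : 0 < Q := by positivity
  set q : ℝ := Q ^ (1 / 2 : ℝ) with hq
  have hq1 : 1 ≤ q := Real.one_le_rpow (by rw [hQ]; simp; positivity) (by norm_num)
  have hq0 : 0 < q := zero_lt_one.trans_le hq1
  have hnorm : ‖s‖ = c * q := by
    rw [hs, Complex.norm_add_mul_I, hq, ← Real.sqrt_eq_rpow, ← Real.sqrt_sq hc.le,
      ← Real.sqrt_mul (sq_nonneg _), hQ, Real.norm_eq_abs, sq_abs, Real.sqrt_sq hc.le]
    congr 1
    field_simp
  have hre : s.re = c := by simp [hs]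
  have hhre : ((h : ℂ) * s).re = h * c := by simp [hre]
  have hhn : ‖(h : ℂ) * s‖ = h * (c * q) := by
    rw [norm_mul, Complex.norm_real, Real.norm_of_nonneg hh.le, hnorm]
  have hpos : 0 < h * (c * q) := by positivity
  have h1 : ‖unitLaplace g (h * s)‖ ≤ C * Real.exp (h * c) * (h * (c * q)) ^ (-k) := by
    have h2 := hU (h * s) (by rw [hhre]; positivity)
    rw [hhre, hhn] at h2
    rw [Real.rpow_neg hpos.le, ← div_eq_mul_inv, le_div_iff₀ (by positivity), mul_comm]
    refine le_trans (mul_le_mul_of_nonneg_right ?_ (norm_nonneg _)) h2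
    calc (h * (c * q)) ^ k ≤ (1 + h * (c * q)) ^ k := by gcongr; linarith
      _ ≤ (1 + h * (c * q)) ^ (⌈k⌉₊ : ℝ) :=
        Real.rpow_le_rpow_of_exponent_le (by linarith) (Nat.le_ceil k)
      _ = _ := Real.rpow_natCast _ _
  have h3 : ‖stepKernel g α h s‖
      ≤ C * Real.exp (h * c) * (h * (c * q)) ^ (-k) / (c * q) * Real.exp (α * c) := by
    rw [stepKernel, norm_mul, norm_div, hnorm, Complex.norm_exp, Complex.re_ofReal_mul, hre]
    gcongr
  have h4 : (1 + ‖s‖) ^ l ≤ ((1 + c) * q) ^ l := by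
    rw [hnorm]
    refine Real.rpow_le_rpow (by positivity) ?_ hl
    nlinarith
  have h5 : Q ^ (-(k + 1 - l) / 2) = q ^ l * q ^ (-k) / q := by
    rw [← Real.rpow_add hq0, ← Real.rpow_sub_one hq0.ne', hq, ← Real.rpow_mul hQ0.le]
    congr 1
    ring
  calc (1 + ‖s‖) ^ l * ‖stepKernel g α h s‖
      ≤ ((1 + c) * q) ^ l
        * (C * Real.exp (h * c) * (h * (c * q)) ^ (-k) / (c * q) * Real.exp (α * c)) := by gcongr
    _ = _ := by
      rw [h5, add_mul α h c, Real.exp_add, Real.mul_rpow (by positivity) hq0.le, ← mul_assoc h c q,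
        Real.mul_rpow (by positivity) hq0.le, mul_comm h c]
      field_simp

/-- The basic estimate for the partial sums of the coefficients. -/
theorem exists_partialSum_bound {k l : ℝ} (hl : 0 ≤ l) (hlk : l < k) :
    ∃ C : ℝ, 0 ≤ C ∧ ∀ (lam : Frequency) (N : ℕ) (a : ℕ → ℂ) (f : RHP → ℂ), IsHolo f →
      IsRieszGerm lam a f → ∀ A : ℝ, 0 ≤ A → (∀ s : RHP, ‖f s‖ ≤ A * (1 + ‖(s : ℂ)‖) ^ l) →
      ‖∑ n ∈ Finset.range (N + 1), a n‖ ≤ C * ((1 + 1 / lam (N + 1)) ^ l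
        * (lam (N + 1) / (lam (N + 1) - lam N)) ^ k) * A := by
  obtain ⟨g, hg, h1⟩ := exists_isUnitBump
  obtain ⟨C, hC, hU⟩ := unitLaplace_decay ⌈k⌉₊ hg
  have hk : 0 ≤ k := (hl.trans_lt hlk).le
  set J : ℝ := ∫ v : ℝ, (1 + ‖v‖ ^ 2) ^ (-(k + 1 - l) / 2) with hJ
  have hJint : MeasureTheory.Integrable fun v : ℝ => (1 + ‖v‖ ^ 2) ^ (-(k + 1 - l) / 2) :=
    -- Integrability on the line requires `k + 1 - l > 1`; this is where `l < k` enters.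
    integrable_rpow_neg_one_add_norm_sq (by
      rw [Module.finrank_self, Nat.cast_one]
      linarith)
  have hJ0 : 0 ≤ J := MeasureTheory.integral_nonneg fun v => by positivity
  refine ⟨C * Real.exp 1 * J / (2 * Real.pi), by positivity, ?_⟩
  rintro lam N a f ⟨F, hF, hFf⟩ ha A hA hb
  set L : ℝ := lam (N + 1) with hL
  have hlt : lam N < L := lam.strictMono' (Nat.lt_succ_self N)
  have hL0 : 0 < L := (lam.nonneg' N).trans_lt hlt
  set h : ℝ := L - lam N with hh
  have hh0 : 0 < h := sub_pos.mpr hlt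
  -- With this abscissa `e^{(λ_N + h) c} = e` and `(c h)^{-k} = (L/h)^k`.
  set c : ℝ := 1 / L with hc
  have hc0 : 0 < c := by positivity
  have hid := integral_germ_stepKernel hg h1 lam N ha hF hFf hA hb hc0
  set M : ℝ := C * Real.exp ((lam N + h) * c) * ((1 + c) ^ l * (c * h) ^ (-k) / c) with hM
  have hnorm : ‖∫ y : ℝ, F (c + y * Complex.I) * stepKernel g (lam N) h (c + y * Complex.I)‖
      ≤ ∫ y : ℝ, A * (M * (1 + ‖c⁻¹ * y‖ ^ 2) ^ (-(k + 1 - l) / 2)) := by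
    refine MeasureTheory.norm_integral_le_of_norm_le
      (((hJint.comp_mul_left' (inv_ne_zero hc0.ne')).const_mul M).const_mul A)
      (Eventually.of_forall fun y => ?_)
    have hre : 0 < ((c : ℂ) + y * Complex.I).re := by simpa using hc0
    have h2 := hb ⟨_, hre⟩
    rw [← hFf ⟨_, hre⟩] at h2
    rw [norm_mul]
    calc _ ≤ A * (1 + ‖(c : ℂ) + y * Complex.I‖) ^ l
          * ‖stepKernel g (lam N) h (c + y * Complex.I)‖ := by gcongr
      _ = A * ((1 + ‖(c : ℂ) + y * Complex.I‖) ^ l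
          * ‖stepKernel g (lam N) h (c + y * Complex.I)‖) := by ring
      _ ≤ _ := mul_le_mul_of_nonneg_left (stepKernel_line_bound hk hl hU hh0 hc0 y) hA
  -- The Jacobian `c` of `y = c v` cancels the `1/c` in `M`.
  have hval : ∫ y : ℝ, A * (M * (1 + ‖c⁻¹ * y‖ ^ 2) ^ (-(k + 1 - l) / 2)) = A * (M * (c * J)) := by
    rw [MeasureTheory.integral_const_mul, MeasureTheory.integral_const_mul,
      MeasureTheory.Measure.integral_comp_mul_left
        (fun v : ℝ => (1 + ‖v‖ ^ 2) ^ (-(k + 1 - l) / 2)) c⁻¹, inv_inv, abs_of_pos hc0,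
      smul_eq_mul]
  have hone : (lam N + h) * c = 1 := by
    rw [hh, hc]; field_simp; ring
  have hratio : (c * h) ^ (-k) = (L / h) ^ k := by
    rw [Real.rpow_neg (by positivity), ← Real.inv_rpow (by positivity), hc]
    congr 1
    field_simp
  rw [hid, hval, norm_mul, norm_mul, Complex.norm_real, Complex.norm_ofNat,
    Real.norm_of_nonneg Real.pi_pos.le, hM, hone, hratio] at hnorm
  rw [div_mul_eq_mul_div, div_mul_eq_mul_div, le_div_iff₀ (by positivity), mul_comm]
  refine hnorm.trans (le_of_eq ?_)
  field_simp

/-! ### From partial sums to the coefficient functional -/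

theorem exists_coeff_bound {k l : ℝ} (hl : 0 ≤ l) (hlk : l < k) :
    ∃ C : ℝ, 0 ≤ C ∧ ∀ (lam : Frequency) (N : ℕ) (a : ℕ → ℂ) (f : DirichletH lam l),
      IsRieszGerm lam a f.toFun → ‖a N‖ ≤ C * ((1 + 1 / lam (N + 1)) ^ l
        * (lam (N + 1) / (lam (N + 1) - lam N)) ^ k
        + (1 + 1 / lam N) ^ l * (lam N / (lam N - lam.prev N)) ^ k) * ‖f‖ := by
  obtain ⟨C, hC, h⟩ := exists_partialSum_bound hl hlk
  refine ⟨C, hC, fun lam N a f ha => ?_⟩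
  have hb : ∀ s : RHP, ‖f.toFun s‖ ≤ ‖f‖ * (1 + ‖(s : ℂ)‖) ^ l := fun s => by
    rw [← div_le_iff₀ (growth_pos l s)]
    exact le_ciSup f.bdd s
  have key := fun n => h lam n a f.toFun f.2.1 ha ‖f‖ (norm_nonneg f) hb
  have hN := key N
  rw [mul_add, add_mul]
  cases N with
  | zero =>
    rw [zero_add, Finset.sum_range_one] at hN
    -- The first coefficient is itself a partial sum, so the second summand is only needed to be
    -- nonnegative.
    refine hN.trans (le_add_of_nonneg_right ?_)
    have h0 := lam.nonneg' 0
    have : 0 ≤ lam 0 / (lam 0 - lam.prev 0) := div_nonneg h0 (by simpa [Frequency.prev] using h0)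
    positivity
  | succ n =>
    rw [Finset.sum_range_succ] at hN
    have h2 : a (n + 1) = (∑ i ∈ Finset.range (n + 1), a i + a (n + 1))
        - ∑ i ∈ Finset.range (n + 1), a i := by ring
    rw [h2]
    exact (norm_sub_le _ _).trans (add_le_add hN (key n))

/-- The difference of two germs of `f` is a germ of `0`, and the coefficient bound has the factor
`‖0‖`. -/
theorem coeff_unique {k l : ℝ} (hl : 0 ≤ l) (hlk : l < k) {lam : Frequency} {a b : ℕ → ℂ}
    {f : DirichletH lam l} (ha : IsRieszGerm lam a f.toFun) (hb : IsRieszGerm lam b f.toFun)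
    (N : ℕ) : a N = b N := by
  obtain ⟨C, _, h⟩ := exists_coeff_bound hl hlk
  have h0 : IsRieszGerm lam (a + (-1 : ℂ) • b) (0 : DirichletH lam l).toFun := by
    have h1 := ha.add (hb.smul (-1))
    have h2 : f.toFun + (-1 : ℂ) • f.toFun = (0 : DirichletH lam l).toFun := by
      rw [neg_one_smul, add_neg_cancel]
      rfl
    rwa [h2] at h1
  have h3 := h lam N _ _ h0
  rw [norm_zero, mul_zero, norm_le_zero_iff] at h3
  simpa [← sub_eq_add_neg, sub_eq_zero] using h3

/-- The coefficient functional. -/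
noncomputable def coeffFunctional {k l : ℝ} (hl : 0 ≤ l) (hlk : l < k) (lam : Frequency) (N : ℕ) :
    DirichletH lam l →ₗ[ℂ] ℂ where
  toFun f := f.2.2.1.choose N
  -- Germs are chosen arbitrarily for each function; linearity holds because the coefficients do not
  -- depend on the choice.
  map_add' f g := coeff_unique hl hlk (f + g).2.2.1.choose_spec
    (f.2.2.1.choose_spec.add g.2.2.1.choose_spec) N
  map_smul' c f := coeff_unique hl hlk (c • f).2.2.1.choose_spec
    (f.2.2.1.choose_spec.smul c) N

theorem one_add_one_div_rpow_le {l μ x : ℝ} (hl : 0 ≤ l) (h : 0 < μ ∧ μ ≤ x ∨ l = 0) :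
    (1 + 1 / x) ^ l ≤ (1 + 1 / μ) ^ l := by
  rcases h with ⟨hμ, hx⟩ | rfl
  · have hx0 := hμ.trans_le hx
    gcongr
  · simp

theorem mainTheorem8 (k l : ℝ) (hl : 0 ≤ l) (hlk : l < k) :
    ∃ C : ℝ → ℝ, ∀ (lam : Frequency) (N : ℕ),
      ∃ T : DirichletH lam l →L[ℂ] ℂ,
        (∀ (f : DirichletH lam l) (a : ℕ → ℂ), IsRieszGerm lam a f.toFun → T f = a N) ∧
        (0 < lam 0 ∨ l = 0 → ‖T‖ ≤ C (lam 0) *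
          ((lam (N + 1) / (lam (N + 1) - lam N)) ^ k + (lam N / (lam N - lam.prev N)) ^ k)) ∧
        (lam 0 = 0 → ‖T‖ ≤ C (lam 1) *
          ((lam (N + 1) / (lam (N + 1) - lam N)) ^ k + (lam N / (lam N - lam.prev N)) ^ k)) := by
  obtain ⟨C, hC, hcoeff⟩ := exists_coeff_bound hl hlk
  -- The factors `(1 + 1/λ_n)^l` decrease in `λ_n > 0`, so the smallest positive frequency serves
  -- for all of them. For `l = 0` they equal `1`, and `μ = 0` does no harm.
  refine ⟨fun μ => C * (1 + 1 / μ) ^ l, fun lam N => ?_⟩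
  have hmono := lam.strictMono'.monotone
  have hN := lam.nonneg' N
  have hN1 := lam.nonneg' (N + 1)
  set X := (lam (N + 1) / (lam (N + 1) - lam N)) ^ k with hX
  set Y := (lam N / (lam N - lam.prev N)) ^ k with hY
  have hX0 : 0 ≤ X :=
    Real.rpow_nonneg (div_nonneg hN1 (sub_nonneg.mpr (hmono (Nat.le_succ N)))) _
  have hY0 : 0 ≤ Y := by
    refine Real.rpow_nonneg (div_nonneg hN (sub_nonneg.mpr ?_)) _
    cases N with
    | zero => exact hN
    | succ n => exact hmono (Nat.le_succ n)
  set B := C * ((1 + 1 / lam (N + 1)) ^ l * X + (1 + 1 / lam N) ^ l * Y) with hB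
  have hB0 : 0 ≤ B := by positivity
  let T := (coeffFunctional hl hlk lam N).mkContinuous B
    fun f => hcoeff lam N _ f f.2.2.1.choose_spec
  have hT : ‖T‖ ≤ B := LinearMap.mkContinuous_norm_le _ hB0 _
  refine ⟨T, fun f a ha => coeff_unique hl hlk f.2.2.1.choose_spec ha N, fun h => ?_, fun h => ?_⟩
  · refine hT.trans ?_
    rw [hB, mul_assoc, mul_add ((1 + 1 / lam 0) ^ l)]
    have hle : ∀ n, 0 < lam 0 ∧ lam 0 ≤ lam n ∨ l = 0 := fun n =>
      h.imp_left fun h0 => ⟨h0, hmono (Nat.zero_le n)⟩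
    have h1 := one_add_one_div_rpow_le hl (hle (N + 1))
    have h2 := one_add_one_div_rpow_le hl (hle N)
    gcongr
  · refine hT.trans ?_
    rw [hB, mul_assoc, mul_add ((1 + 1 / lam 1) ^ l)]
    have hpos : 0 < lam 1 := h ▸ lam.strictMono' zero_lt_one
    have h1 := one_add_one_div_rpow_le hl (.inl ⟨hpos, hmono (Nat.le_add_left 1 N)⟩)
    have h2 : (1 + 1 / lam N) ^ l * Y ≤ (1 + 1 / lam 1) ^ l * Y := by
      cases N with
      | zero =>
        -- For `N = 0` and `lam 0 = 0` the quotient is `0 / 0 = 0` and `0 ^ k = 0` since `k > 0`: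
        -- the second summand is then `0`, as the convention demands.
        have : Y = 0 := by
          rw [hY, h, zero_div, Real.zero_rpow (hl.trans_lt hlk).ne']
        rw [this, mul_zero, mul_zero]
      | succ n =>
        have h3 := one_add_one_div_rpow_le hl (.inl ⟨hpos, hmono (Nat.le_add_left 1 n)⟩)
        gcongr
    gcongr
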